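/- A standard word of length $n$ is a word $w=w_1\cdots w_n$ in which each of $1,\dots,n$ occurs exactly once. Its cocharge labeling $\mathrm{cl}(w)$ is the word of the same length obtained by replacing every number of $w$ by its label, where $1$ has label $0$ and, if $i$ has label $k$, then $i+1$ has label $k$ if it appears to the right of $i$ in $w$ and label $k+1$ if it appears to the left of $i$. For a partition $\nu$, let $Z_\nu$ be the tableau of shape $\nu$ (English notation) with $0$'s in its first row, $1$'s in its second row, and so on. For a tableau $T$, $\mathrm{rowword}(T)$ is the word obtained by reading the rows of $T$ from bottom to top, each from left to right. $P(w)$ denotes the (Schensted row) insertion tableau of a word $w$. The catabolism insertion algorithm. For a word $x=ya$ with last number $a\ge 0$ and a partition $\nu$, put \[ f(ya,\nu)=\begin{cases}(y,\ \nu+\epsilon_{a+1}) & \text{if }\nu+\epsilon_{a+1}\text{ is a partition},\\ ((a+1)\,y,\ \nu) & \text{otherwise,}\end{cases} \] where $\epsilon_i$ is the $i$-th standard basis vector. With input a standard word $u$, apply $f$ repeatedly, starting from the pair $(\mathrm{cl}(u),\varnothing)$, and stop when the word of the pair is empty. The output $F(u)$ is the partition of the final pair. Transformations. Let $u$ be a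 standard word. - $v$ is a non-zero corotation of $u$ if $u=wa$ and $v=aw$ for a word $w$ and a number $a\ne 1$ whose label in $\mathrm{cl}(u)$ is greater than $0$. - $u\rightsquigarrow v$ is a catabolism transformation if $v$ is obtained from $u$ by swapping two adjacent numbers whose labels in $\mathrm{cl}(u)$ differ by more than $1$. - $u\rightsquigarrow v$ is a Knuth transformation if $v$ is obtained from $u$ by replacing three consecutive numbers according to $bac\leftrightarrow bca$ or $acb\leftrightarrow cab$, in either direction, where $a<b<c$. Catabolizability. Let $T$ be a tableau with distinct entries. If the first row of $T$ has at least $m$ entries, then $\mathrm{Cat}_m(T)$ is the insertion tableau of the word obtained by concatenating the first row of $T$ without its first $m$ entries and the row reading word of the remaining rows of $T$. For a partition $\lambda=(\lambda_1,\widehat\lambda)$ of $|T|$, $T$ is $\lambda$-catabolizable if the first row of $T$ has at least $\lambda_1$ entries, its first $\lambda_1$ entries are the $\lambda_1$ smallest entries of $T$, and $\mathrm{Cat}_{\lambda_1}(T)$ is $\widehat\lambda$-catabolizable; the empty tableau is $\varnothing$-catabolizable. The catabolizability $\mathrm{ctype}(T)$ is the unique maximal partition in dominance order among the partitions $\lambda$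 of $|T|$ such that $T$ is $\lambda$-catabolizable. **Theorem.** The catabolism insertion algorithm, with input a standard word $u$ of length $n$, satisfies: (i) after every step, the word-partition pair $(x,\nu)$ is such that $x\,\mathrm{rowword}(Z_\nu)$ is the cocharge labeling of some standard word (of length $n$); (ii) it terminates in at most $n+\binom n2$ steps; (iii) $F(u)=F(v)$ if $v$ is a non-zero corotation of $u$; (iv) $F(u)=F(v)$ if $u\rightsquigarrow v$ is a catabolism transformation; (v) $F(u)=F(v)$ if $u\rightsquigarrow v$ is a Knuth transformation; (vi) $\mathrm{ctype}(P(u))$ is well defined and $F(u)=\mathrm{ctype}(P(u))$. -/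

import Mathlib

namespace CatabolismInsertion

/-! Words are lists of natural numbers, read from left to right. Partitions are lists of their
(positive, weakly decreasing) parts. Tableaux are drawn in English notation and are given by the
list of their nonempty rows, from north to south, each row read from west to east. -/

/-- `w` is a standard word of length `n`: a rearrangement of `1, …, n`. -/
def IsStandardWord (n : ℕ) (w : List ℕ) : Prop :=
  w.Perm (List.range' 1 n)

/-! ### Cocharge labelings -/

/-- The label of the number `i` of the standard word `w`: the number `1` is labeled `0`, and
`i + 1` has the label of `i` if it appears to the right of `i` in `w`, and the label of `i` plus
one if it appears to the left of `i`. (The value at the number `0`, which does not occur in a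
standard word, is irrelevant.) -/
def cochargeLabel (w : List ℕ) : ℕ → ℕ
  | 0 => 0
  | 1 => 0
  | i + 2 =>
    if w.idxOf (i + 2) < w.idxOf (i + 1) then cochargeLabel w (i + 1) + 1
    else cochargeLabel w (i + 1)

/-- The cocharge labeling of the standard word `w`: each number replaced by its label. -/
def cochargeLabeling (w : List ℕ) : List ℕ :=
  w.map (cochargeLabel w)

/-! ### Transformations of standard words -/

/-- `v` is a non-zero corotation of `u`: `u = w a` and `v = a w` with `a ≠ 1`, and `a` has a
non-zero label in the cocharge labeling of `u`. -/
def IsNonzeroCorotation (u v : List ℕ) : Prop :=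
  ∃ (w : List ℕ) (a : ℕ), u = w ++ [a] ∧ v = a :: w ∧ a ≠ 1 ∧ 0 < cochargeLabel u a

/-- `v` is obtained from `u` by a catabolism transformation: two adjacent numbers, whose labels
in the cocharge labeling of `u` differ by more than one, are swapped. -/
def IsCatabolismTransformation (u v : List ℕ) : Prop :=
  ∃ (p q : List ℕ) (a b : ℕ), u = p ++ [a, b] ++ q ∧ v = p ++ [b, a] ++ q ∧
    1 < |(cochargeLabel u a : ℤ) - (cochargeLabel u b : ℤ)|

/-- `v` is obtained from the standard word `u` by an elementary Knuth transformation
`⋯ b a c ⋯ ↔ ⋯ b c a ⋯` or `⋯ a c b ⋯ ↔ ⋯ c a b ⋯` with `a < b < c`, in either direction. -/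
def IsKnuthTransformation (u v : List ℕ) : Prop :=
  ∃ (p q : List ℕ) (a b c : ℕ), a < b ∧ b < c ∧
    ((u = p ++ [b, a, c] ++ q ∧ v = p ++ [b, c, a] ++ q) ∨
     (u = p ++ [b, c, a] ++ q ∧ v = p ++ [b, a, c] ++ q) ∨
     (u = p ++ [a, c, b] ++ q ∧ v = p ++ [c, a, b] ++ q) ∨
     (u = p ++ [c, a, b] ++ q ∧ v = p ++ [a, c, b] ++ q))

/-! ### Partitions -/

/-- A list of natural numbers is a partition: weakly decreasing, with positive parts. -/
def IsPartition (lam : List ℕ) : Prop :=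
  lam.Pairwise (fun a b => b ≤ a) ∧ ∀ a ∈ lam, 0 < a

instance (lam : List ℕ) : Decidable (IsPartition lam) := by
  unfold IsPartition; infer_instance

/-- The vector sum `ν + ε_{a+1}`, i.e. the entry of `ν` in (zero-based) position `a` is increased
by one, where `ν` is first padded by zeros up to that position if necessary. -/
def addUnit : List ℕ → ℕ → List ℕ
  | [], 0 => [1]
  | [], a + 1 => 0 :: addUnit [] a
  | k :: nu, 0 => (k + 1) :: nu
  | k :: nu, a + 1 => k :: addUnit nu a

/-- `mu` is at most `lam` in dominance order (used for partitions of the same number). -/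
def DominanceLE (mu lam : List ℕ) : Prop :=
  ∀ k, (mu.take k).sum ≤ (lam.take k).sum

/-! ### Tableaux -/

/-- Row insertion of `a` into a single row: the leftmost entry greater than `a` is replaced by
`a` and bumped; if there is none, `a` is appended. Returns the new row and the bumped entry. -/
def rowInsert : List ℕ → ℕ → List ℕ × Option ℕ
  | [], a => ([a], none)
  | b :: r, a =>
    if a < b then (a :: r, some b) else (b :: (rowInsert r a).1, (rowInsert r a).2)

/-- Schensted row insertion of `a` into a tableau. -/
def tableauInsert : List (List ℕ) → ℕ → List (List ℕ)
  | [], a => [[a]]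
  | r :: T, a =>
    match rowInsert r a with
    | (r', none) => r' :: T
    | (r', some b) => r' :: tableauInsert T b

/-- The insertion tableau `P(w)` of the word `w`. -/
def insertionTableau (w : List ℕ) : List (List ℕ) :=
  w.foldl tableauInsert []

/-- The row reading word of a tableau: the rows from south to north, each from west to east. -/
def rowWord (T : List (List ℕ)) : List ℕ :=
  T.reverse.flatten

/-- The superstandard tableau `Z_ν` of shape `ν`: `0`'s in the first row, `1`'s in the second
row, and so on. -/
def superstandard (nu : List ℕ) : List (List ℕ) :=
  nu.mapIdx (fun i k => List.replicate k i)

/-- For `m` at most the length of the first row of `T`, the word `T_n T_s`, where `T_n` and `T_s`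
are (the row reading words of) the first row and the remaining rows of the skew tableau obtained
from `T` by removing the first `m` entries of its first row. -/
def sliceWord (m : ℕ) (T : List (List ℕ)) : List ℕ :=
  (T.headD []).drop m ++ rowWord T.tail

/-- The `m`-catabolism `Cat_m(T)`, for `m` at most the length of the first row of `T`. -/
def catabolism (m : ℕ) (T : List (List ℕ)) : List (List ℕ) :=
  insertionTableau (sliceWord m T)

/-- `T` (with distinct entries) is `λ`-catabolizable. In the inductive clause, the first row of `T`
has at least `m = λ₁` entries, its first `m` entries are the `m` smallest entries of `T` (smaller
than all the others), and the `m`-catabolism of `T` is catabolizable for the remaining parts. -/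
def IsCatabolizable : List ℕ → List (List ℕ) → Prop
  | [], T => T = []
  | m :: lam, T =>
    m ≤ (T.headD []).length ∧
    (∀ a ∈ (T.headD []).take m, ∀ b ∈ sliceWord m T, a < b) ∧
    IsCatabolizable lam (catabolism m T)

/-- `lam` is the catabolizability `ctype(T)`: the greatest element in dominance order (for a finite
set of partitions, this is the same as the unique maximal element) among the partitions `mu` of
`|T|` for which `T` is `mu`-catabolizable. -/
def IsCtype (T : List (List ℕ)) (lam : List ℕ) : Prop :=
  (IsPartition lam ∧ lam.sum = T.flatten.length ∧ IsCatabolizable lam T) ∧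
  ∀ mu : List ℕ, IsPartition mu → mu.sum = T.flatten.length → IsCatabolizable mu T →
    DominanceLE mu lam

/-! ### The catabolism insertion algorithm -/

/-- One step of the algorithm on a word-partition pair `(y a, ν)`: the last number `a` is inserted
if `ν + ε_{a+1}` is a partition, and corotated (becoming `a + 1`) otherwise. The algorithm has
stopped once the word is empty, and then the pair does not change any more. -/
def step : List ℕ × List ℕ → List ℕ × List ℕ
  | (x, nu) =>
    match x.getLast? with
    | none => (x, nu)
    | some a =>
      if IsPartition (addUnit nu a) then (x.dropLast, addUnit nu a)
      else ((a + 1) :: x.dropLast, nu)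

/-- The word-partition pair after `k` steps of the algorithm with input `u`, which starts from
the cocharge labeling of `u` and the empty partition. -/
def state (u : List ℕ) (k : ℕ) : List ℕ × List ℕ :=
  step^[k] (cochargeLabeling u, [])

open Classical in
/-- The output `F(u)`: the partition of the pair when the word becomes empty for the first time
(with the junk value `[]` if that never happens). -/
noncomputable def output (u : List ℕ) : List ℕ :=
  if h : ∃ k, (state u k).1 = [] then (state u (Nat.find h)).2 else []

end CatabolismInsertion

open CatabolismInsertion

/-!
The algorithm is studied on words of labels. Call a word a cocharge word if, whenever `k + 1` occurs
in it, some `k + 1` stands to the left of some `k` (`IsCocharge`). By standardization these are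
exactly the cocharge labelings of standard words, so that the first claim says that a step preserves
the cocharge condition on `x rowword(Z_ν)` (`IsCocharge.step`). A step shortens `x` or increases by
one the sum of the letters of `x rowword(Z_ν)`, which is at most `n choose 2` for a cocharge
labeling; this bounds the number of steps.

A non-zero corotation of `u` is the first step of the algorithm, performed on `u` itself. A
catabolism or Knuth transformation of `u` changes the labels either by a swap of adjacent letters
that differ by more than one, or by a Knuth move on two consecutive letters `a`, `a + 1`
(`LocalMove`). When the algorithm has passed over the two sides of such a move, the partitions are
the same, and the words of corotated letters are equal or again related by such a move
(`LocalMove.pass_rel`). Hence the outputs agree (`WordMove.hasOutput`).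

For the catabolizability, `u` may be replaced by the row reading word of `P(u)`, which is Knuth
equivalent to `u`. Let `k` be the number of letters of label `0`. They are the first `k` entries of
the first row. The algorithm corotates the rest of the first row, inserts the `k` zeros, and is then
left with the labels, raised by one, of the slice word whose insertion tableau is `Cat_k(P(u))`. By
the column condition at most `k` of these letters are ones, so the first row of length `k` never
interferes, and `F(u)` is `k` followed by the output for the slice word
(`LabeledTableau.hasOutput`). By induction `P(u)` is `F(u)`-catabolizable. Conversely, let `P(u)` be
`(m, λ)`-catabolizable. Then `m ≤ k`, and the labels of the slice word for `m` arise from those of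
the slice word for `k` by putting `k - m` zeros in front. These zeros only lengthen the first row of
the output by `k - m`, because letters that have been corotated are at least `2` and thus do not
depend on the length of the first row (`HasOutput.zero_cons`). Together with the induction
hypothesis for the slice word for `m`, this bounds the partial sums of `(m, λ)` by those of `F(u)`.
-/

namespace CatabolismInsertion

/-! ### Partitions and the insertion condition -/

theorem isPartition_cons (k : ℕ) (nu : List ℕ) :
    IsPartition (k :: nu) ↔ 0 < k ∧ nu.getD 0 0 ≤ k ∧ IsPartition nu := by
  unfold IsPartition
  cases nu with
  | nil => simp
  | cons j nu =>
    simp only [List.pairwise_cons, List.mem_cons, forall_eq_or_imp, List.getD_cons_zero]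
    constructor
    · rintro ⟨⟨⟨h1, h2⟩, h3⟩, h4, h5, h6⟩
      exact ⟨h4, h1, h3, h5, h6⟩
    · rintro ⟨h4, h1, h3, h5, h6⟩
      exact ⟨⟨⟨h1, fun a ha => (h3.1 a ha).trans h1⟩, h3⟩, h4, h5, h6⟩

theorem isPartition_nil : IsPartition [] := by simp [IsPartition]

theorem getD_addUnit (nu : List ℕ) (a i : ℕ) :
    (addUnit nu a).getD i 0 = nu.getD i 0 + if i = a then 1 else 0 := by
  induction nu generalizing a i with
  | nil =>
    induction a generalizing i with
    | zero => cases i <;> simp [addUnit]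
    | succ a ih =>
      cases i with
      | zero => simp [addUnit]
      | succ i => simpa [addUnit] using ih i
  | cons k nu ih =>
    cases a with
    | zero => cases i <;> simp [addUnit]
    | succ a =>
      cases i with
      | zero => simp [addUnit]
      | succ i => simpa [addUnit] using ih a i

theorem addUnit_comm (nu : List ℕ) (a b : ℕ) :
    addUnit (addUnit nu a) b = addUnit (addUnit nu b) a := by
  induction nu generalizing a b with
  | nil =>
    induction a generalizing b with
    | zero => cases b <;> simp [addUnit]
    | succ a ih =>
      cases b with
      | zero => simp [addUnit]
      | succ b => simpa [addUnit] using ih b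
  | cons k nu ih =>
    cases a <;> cases b <;> simp [addUnit]
    exact ih _ _

/-- The letter `a` can be inserted if and only if `a = 0` or the row above the row of `a` is
longer. -/
theorem isPartition_addUnit_iff {nu : List ℕ} (h : IsPartition nu) (a : ℕ) :
    IsPartition (addUnit nu a) ↔ a = 0 ∨ nu.getD a 0 < nu.getD (a - 1) 0 := by
  induction nu generalizing a with
  | nil =>
    cases a with
    | zero => simp [addUnit, IsPartition]
    | succ a => simp [addUnit, IsPartition]
  | cons k nu ih =>
    rw [isPartition_cons] at h
    cases a with
    | zero => simpa [addUnit, isPartition_cons, h.2.2] using Nat.le_succ_of_le h.2.1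
    | succ a =>
      rw [addUnit, isPartition_cons, getD_addUnit, ih h.2.2]
      cases a with
      | zero =>
        simp only [if_true, true_or, and_true, Nat.zero_add, List.getD_cons_succ, Nat.sub_self,
          List.getD_cons_zero]
        omega
      | succ a =>
        have h1 := h.1
        have h2 := h.2.1
        simp only [List.getD_cons_succ, Nat.add_sub_cancel]
        simp [h1]
        intro _
        simpa using h2

theorem getD_antitone {nu : List ℕ} (h : IsPartition nu) (i : ℕ) :
    nu.getD (i + 1) 0 ≤ nu.getD i 0 := by
  induction nu generalizing i with
  | nil => simp
  | cons k nu ih =>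
    rw [isPartition_cons] at h
    cases i with
    | zero => simpa using h.2.1
    | succ i => simpa using ih h.2.2 i

/-- The parts of a partition are read with the default value `0` beyond its length. -/
theorem getD_pos_iff {nu : List ℕ} (h : IsPartition nu) (i : ℕ) :
    0 < nu.getD i 0 ↔ i < nu.length := by
  constructor
  · intro hi
    by_contra hc
    simp [not_lt.mp hc] at hi
  · intro hi
    rw [List.getD_eq_getElem _ _ hi]
    exact h.2 _ (List.getElem_mem hi)

/-! ### Passes of the algorithm -/

/-- The algorithm applied to the letters of a word, from right to left, with the corotated letters
collected in a separate word: `pass t ν` is the word of the corotated letters of `t`, each raised by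
one, together with the resulting partition. The corotated letters keep their order. -/
def pass : List ℕ → List ℕ → List ℕ × List ℕ
  | [], nu => ([], nu)
  | a :: t, nu =>
    if IsPartition (addUnit (pass t nu).2 a) then ((pass t nu).1, addUnit (pass t nu).2 a)
    else ((a + 1) :: (pass t nu).1, (pass t nu).2)

theorem step_append_singleton (y nu : List ℕ) (a : ℕ) :
    step (y ++ [a], nu) =
      if IsPartition (addUnit nu a) then (y, addUnit nu a) else ((a + 1) :: y, nu) := by
  simp [step]

theorem step_nil (nu : List ℕ) : step ([], nu) = ([], nu) := rfl

theorem iterate_step_nil (nu : List ℕ) (k : ℕ) : step^[k] ([], nu) = ([], nu) :=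
  Function.iterate_fixed (step_nil nu) k

theorem pass_append (s t nu : List ℕ) :
    pass (s ++ t) nu =
      ((pass s (pass t nu).2).1 ++ (pass t nu).1, (pass s (pass t nu).2).2) := by
  induction s with
  | nil => simp [pass]
  | cons a s ih =>
    simp only [List.cons_append, pass, ih]
    split_ifs <;> rfl

/-- Running the algorithm over the last letters `t` of a word. -/
theorem iterate_step_append (x t nu : List ℕ) :
    step^[t.length] (x ++ t, nu) = ((pass t nu).1 ++ x, (pass t nu).2) := by
  induction t generalizing x with
  | nil => simp [pass]
  | cons a t ih =>
    have := ih (x ++ [a])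
    rw [List.append_assoc, List.singleton_append] at this
    rw [List.length_cons, Function.iterate_succ_apply', this, ← List.append_assoc,
      step_append_singleton, pass]
    split_ifs <;> rfl

theorem isPartition_pass {nu : List ℕ} (h : IsPartition nu) (t : List ℕ) :
    IsPartition (pass t nu).2 := by
  induction t with
  | nil => exact h
  | cons a t ih =>
    simp only [pass]
    split_ifs with h'
    · exact h'
    · exact ih

theorem isPartition_step {s : List ℕ × List ℕ} (h : IsPartition s.2) : IsPartition (step s).2 := by
  obtain ⟨x, nu⟩ := s
  rcases List.eq_nil_or_concat x with rfl | ⟨y, a, rfl⟩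
  · exact h
  · rw [List.concat_eq_append, step_append_singleton]
    split_ifs with h'
    · exact h'
    · exact h

/-- The algorithm started from the word-partition pair `s` stops with the partition `mu`. -/
def HasOutput (s : List ℕ × List ℕ) (mu : List ℕ) : Prop :=
  ∃ k, step^[k] s = ([], mu)

theorem iterate_step_of_le {s : List ℕ × List ℕ} {mu : List ℕ} {k l : ℕ}
    (h : step^[k] s = ([], mu)) (hkl : k ≤ l) : step^[l] s = ([], mu) := by
  obtain ⟨m, rfl⟩ := Nat.exists_eq_add_of_le' hkl
  rw [Function.iterate_add_apply, h, iterate_step_nil]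

theorem hasOutput_unique {s : List ℕ × List ℕ} {mu mu' : List ℕ} (h : HasOutput s mu)
    (h' : HasOutput s mu') : mu = mu' := by
  obtain ⟨k, hk⟩ := h
  obtain ⟨l, hl⟩ := h'
  have h1 := iterate_step_of_le hk (le_max_left k l)
  have h2 := iterate_step_of_le hl (le_max_right k l)
  rw [h1] at h2
  exact (Prod.mk.inj h2).2

theorem hasOutput_iterate {s : List ℕ × List ℕ} {mu : List ℕ} (k : ℕ) :
    HasOutput (step^[k] s) mu ↔ HasOutput s mu := by
  constructor
  · rintro ⟨l, hl⟩
    exact ⟨l + k, by rw [Function.iterate_add_apply, hl]⟩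
  · rintro ⟨l, hl⟩
    refine ⟨l, ?_⟩
    rw [← Function.iterate_add_apply]
    exact iterate_step_of_le hl (Nat.le_add_right l k)

theorem hasOutput_append {x t nu mu : List ℕ} :
    HasOutput (x ++ t, nu) mu ↔ HasOutput ((pass t nu).1 ++ x, (pass t nu).2) mu := by
  rw [← iterate_step_append, hasOutput_iterate]

theorem HasOutput.isPartition {s : List ℕ × List ℕ} {mu : List ℕ} (h : HasOutput s mu)
    (hs : IsPartition s.2) : IsPartition mu := by
  obtain ⟨k, hk⟩ := h
  have : ∀ k, IsPartition (step^[k] s).2 := by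
    intro k
    induction k with
    | zero => exact hs
    | succ k ih => rw [Function.iterate_succ_apply']; exact isPartition_step ih
  simpa [hk] using this k

theorem output_eq {u mu : List ℕ} (h : HasOutput (cochargeLabeling u, []) mu) :
    output u = mu := by
  have hex : ∃ k, (state u k).1 = [] := by
    obtain ⟨k, hk⟩ := h
    exact ⟨k, by simp [state, hk]⟩
  classical
  rw [output, dif_pos hex]
  refine hasOutput_unique (s := (cochargeLabeling u, [])) ⟨Nat.find hex, ?_⟩ h
  exact Prod.ext (Nat.find_spec hex) rfl

/-! ### Local moves on words of labels -/

/-- The local moves on words of labels under which the output of the algorithm does not change: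
swaps of two letters that differ by more than one, and Knuth moves on two consecutive letters. -/
inductive LocalMove : List ℕ → List ℕ → Prop
  | swap (a b : ℕ) (h : a + 1 < b ∨ b + 1 < a) : LocalMove [a, b] [b, a]
  | bab (a : ℕ) : LocalMove [a + 1, a, a + 1] [a + 1, a + 1, a]
  | bba (a : ℕ) : LocalMove [a + 1, a + 1, a] [a + 1, a, a + 1]
  | aba (a : ℕ) : LocalMove [a, a + 1, a] [a + 1, a, a]
  | baa (a : ℕ) : LocalMove [a + 1, a, a] [a, a + 1, a]

/-- Two words are equal or differ by a local move inside a common context. -/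
def WordMove (x y : List ℕ) : Prop :=
  ∃ p q t t', x = p ++ t ++ q ∧ y = p ++ t' ++ q ∧ (t = t' ∨ LocalMove t t')

theorem LocalMove.symm {t t' : List ℕ} (h : LocalMove t t') : LocalMove t' t := by
  cases h with
  | swap a b h => exact .swap b a h.symm
  | bab a => exact .bba a
  | bba a => exact .bab a
  | aba a => exact .baa a
  | baa a => exact .aba a

/-- The two sides of a local move build up the same partition, and the words of their corotated
letters are equal or again related by a local move. -/
theorem LocalMove.pass_rel {t t' nu : List ℕ} (h : LocalMove t t') (hnu : IsPartition nu) :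
    (pass t nu).2 = (pass t' nu).2 ∧
      ((pass t nu).1 = (pass t' nu).1 ∨ LocalMove (pass t nu).1 (pass t' nu).1) := by
  -- each side of a symmetric pair of moves is treated once
  wlog hw : (∃ a b, a + 1 < b ∧ t = [a, b] ∧ t' = [b, a]) ∨
      (∃ a, t = [a + 1, a, a + 1] ∧ t' = [a + 1, a + 1, a]) ∨
      (∃ a, t = [a, a + 1, a] ∧ t' = [a + 1, a, a]) generalizing t t'
  · have hs := this h.symm (by
      cases h with
      | swap a b h =>
        rcases h with h | h
        · exact absurd (Or.inl ⟨a, b, h, rfl, rfl⟩) hw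
        · exact Or.inl ⟨b, a, h, rfl, rfl⟩
      | bab a => exact absurd (Or.inr (Or.inl ⟨a, rfl, rfl⟩)) hw
      | bba a => exact Or.inr (Or.inl ⟨a, rfl, rfl⟩)
      | aba a => exact absurd (Or.inr (Or.inr ⟨a, rfl, rfl⟩)) hw
      | baa a => exact Or.inr (Or.inr ⟨a, rfl, rfl⟩))
    exact ⟨hs.1.symm, hs.2.imp Eq.symm LocalMove.symm⟩
  have hmono := getD_antitone hnu
  rcases hw with ⟨a, b, hab, rfl, rfl⟩ | ⟨a, rfl, rfl⟩ | ⟨a, rfl, rfl⟩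
  · have hA := isPartition_addUnit_iff hnu a
    have hB := isPartition_addUnit_iff hnu b
    have hAB : IsPartition (addUnit nu a) → (IsPartition (addUnit (addUnit nu a) b) ↔
        IsPartition (addUnit nu b)) := by
      intro h
      rw [isPartition_addUnit_iff h, hB]
      simp only [getD_addUnit]
      split_ifs <;> omega
    have hBA : IsPartition (addUnit nu b) → (IsPartition (addUnit (addUnit nu b) a) ↔
        IsPartition (addUnit nu a)) := by
      intro h
      rw [isPartition_addUnit_iff h, hA]
      simp only [getD_addUnit]
      split_ifs <;> omega
    by_cases h1 : IsPartition (addUnit nu a) <;> by_cases h2 : IsPartition (addUnit nu b) <;>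
      simp only [pass, h1, h2, hAB, hBA, if_true, if_false, true_or, and_true, true_and]
    · exact addUnit_comm nu b a
    · exact Or.inr (.swap _ _ (by omega))
  all_goals
    have hA := isPartition_addUnit_iff hnu a
    have hB := isPartition_addUnit_iff hnu (a + 1)
    rw [Nat.add_sub_cancel] at hB
    have ha := hmono a
    have hAB : IsPartition (addUnit nu a) → IsPartition (addUnit (addUnit nu a) (a + 1)) := by
      intro h
      rw [isPartition_addUnit_iff h]
      simp only [getD_addUnit, Nat.add_sub_cancel]
      split_ifs <;> omega
    have hBA : IsPartition (addUnit nu (a + 1)) →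
        (IsPartition (addUnit (addUnit nu (a + 1)) a) ↔ IsPartition (addUnit nu a)) := by
      intro h
      rw [isPartition_addUnit_iff h, hA]
      simp only [getD_addUnit]
      split_ifs <;> omega
  · have hABB : IsPartition (addUnit nu a) →
        (IsPartition (addUnit (addUnit (addUnit nu a) (a + 1)) (a + 1)) ↔
          IsPartition (addUnit nu (a + 1))) := by
      intro h
      rw [isPartition_addUnit_iff (hAB h), hB]
      simp only [getD_addUnit, Nat.add_sub_cancel]
      simp
    by_cases h1 : IsPartition (addUnit nu a) <;> by_cases h2 : IsPartition (addUnit nu (a + 1))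
    · simp [pass, h1, h2, hAB, hABB, addUnit_comm nu (a + 1) a]
    · simp [pass, h1, h2, hAB, hABB]
    · by_cases h3 : IsPartition (addUnit (addUnit nu (a + 1)) (a + 1)) <;>
        simp [pass, h1, h2, h3, hBA]
    · simpa [pass, h1, h2] using LocalMove.bab (a + 1)
  · have hABA : IsPartition (addUnit nu a) →
        (IsPartition (addUnit (addUnit (addUnit nu a) (a + 1)) a) ↔
          IsPartition (addUnit (addUnit nu a) a)) := by
      intro h
      rw [isPartition_addUnit_iff (hAB h), isPartition_addUnit_iff h]
      simp only [getD_addUnit]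
      split_ifs <;> omega
    by_cases h1 : IsPartition (addUnit nu a)
    · by_cases h3 : IsPartition (addUnit (addUnit nu a) a)
      · simp [pass, h1, h3, hAB, hABA, addUnit_comm (addUnit nu a) a (a + 1)]
      · simp [pass, h1, h3, hAB, hABA]
    · by_cases h2 : IsPartition (addUnit nu (a + 1))
      · simp [pass, h1, h2, hBA]
      · simpa [pass, h1, h2] using LocalMove.aba (a + 1)

theorem WordMove.pass_rel {x y nu : List ℕ} (h : WordMove x y) (hnu : IsPartition nu) :
    (pass x nu).2 = (pass y nu).2 ∧ WordMove (pass x nu).1 (pass y nu).1 := by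
  obtain ⟨p, q, t, t', rfl, rfl, h⟩ := h
  have hl : (pass t (pass q nu).2).2 = (pass t' (pass q nu).2).2 ∧
      ((pass t (pass q nu).2).1 = (pass t' (pass q nu).2).1 ∨
        LocalMove (pass t (pass q nu).2).1 (pass t' (pass q nu).2).1) := by
    rcases h with rfl | h
    · exact ⟨rfl, Or.inl rfl⟩
    · exact h.pass_rel (isPartition_pass hnu q)
  simp only [pass_append, List.append_assoc]
  rw [hl.1]
  exact ⟨rfl, _, _, _, _, (List.append_assoc _ _ _).symm, (List.append_assoc _ _ _).symm, hl.2⟩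

theorem WordMove.hasOutput {x y nu mu : List ℕ} (h : WordMove x y) (hnu : IsPartition nu)
    (ho : HasOutput (x, nu) mu) : HasOutput (y, nu) mu := by
  obtain ⟨k, hk⟩ := ho
  induction k generalizing x y nu with
  | zero =>
    obtain ⟨rfl, rfl⟩ := Prod.mk.inj hk
    obtain ⟨p, q, t, t', hx, rfl, h⟩ := h
    simp only [List.nil_eq, List.append_eq_nil_iff] at hx
    obtain ⟨⟨rfl, rfl⟩, rfl⟩ := hx
    rcases h with rfl | h
    · exact ⟨0, rfl⟩
    · cases h
  | succ k ih =>
    have hp := h.pass_rel hnu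
    have hx := iterate_step_append [] x nu
    rw [List.append_nil, List.nil_append] at hx
    rw [show (y, nu) = ([] ++ y, nu) from rfl, hasOutput_append, List.append_nil]
    rcases Nat.eq_zero_or_pos x.length with hl | hl
    · obtain rfl := List.eq_nil_of_length_eq_zero hl
      rw [iterate_step_nil] at hk
      obtain ⟨-, rfl⟩ := Prod.mk.inj hk
      obtain ⟨p, q, t, t', hx, rfl, h⟩ := h
      simp only [List.nil_eq, List.append_eq_nil_iff] at hx
      obtain ⟨⟨rfl, rfl⟩, rfl⟩ := hx
      rcases h with rfl | h
      · exact ⟨0, rfl⟩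
      · cases h
    · rw [← hp.1]
      refine ih hp.2 (isPartition_pass hnu x) ?_
      rw [← hx, ← Function.iterate_add_apply]
      exact iterate_step_of_le hk (by omega)

/-! ### Cocharge labelings of words with distinct letters -/

/-- The condition that characterizes the cocharge labelings of standard words: if `k + 1` occurs,
then some `k + 1` stands to the left of some `k`. -/
def IsCocharge (c : List ℕ) : Prop :=
  ∀ k, k + 1 ∈ c → [k + 1, k].Sublist c

/-- The relation between the letter `a` and the letter `b` to its right in a word that is the
standardization of its word of labels `ℓ`: letters increase with their labels, and those with equal
labels increase from left to right. -/
def LabelRel (l : ℕ → ℕ) (a b : ℕ) : Prop :=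
  (a < b ∧ l a ≤ l b) ∨ (b < a ∧ l b < l a)

/-- `l` is the cocharge labeling of the word `w`, whose letters are distinct but otherwise
arbitrary: `w` standardizes its word of labels, which is a cocharge word. -/
def IsLabeling (l : ℕ → ℕ) (w : List ℕ) : Prop :=
  w.Pairwise (LabelRel l) ∧ IsCocharge (w.map l)

theorem pair_sublist_append {a b : ℕ} {s t : List ℕ} :
    [a, b].Sublist (s ++ t) ↔ [a, b].Sublist s ∨ [a, b].Sublist t ∨ (a ∈ s ∧ b ∈ t) := by
  induction s with
  | nil => simp
  | cons c s ih =>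
    rw [List.cons_append, List.sublist_cons_iff, List.sublist_cons_iff, ih]
    simp only [List.cons.injEq, List.mem_cons, ↓existsAndEq, and_true, List.singleton_sublist,
      List.mem_append]
    grind

theorem pair_sublist_cons {a b c : ℕ} {t : List ℕ} :
    [a, b].Sublist (c :: t) ↔ [a, b].Sublist t ∨ (a = c ∧ b ∈ t) := by
  have := pair_sublist_append (a := a) (b := b) (s := [c]) (t := t)
  rw [List.singleton_append] at this
  rw [this]
  simp

theorem LocalMove.perm {t t' : List ℕ} (h : LocalMove t t') : t.Perm t' := by
  cases h with
  | swap a b h => exact .swap _ _ _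
  | bab a => exact .cons _ (.swap _ _ _)
  | bba a => exact .cons _ (.swap _ _ _)
  | aba a => exact .swap _ _ _
  | baa a => exact .swap _ _ _

theorem LocalMove.pair_sublist {t t' : List ℕ} (h : LocalMove t t') {k : ℕ}
    (hk : [k + 1, k].Sublist t) : [k + 1, k].Sublist t' := by
  cases h <;> simp [pair_sublist_cons] at hk ⊢ <;> omega

theorem IsCocharge.of_wordMove {x y : List ℕ} (hx : IsCocharge x) (h : WordMove x y) :
    IsCocharge y := by
  obtain ⟨p, q, t, t', rfl, rfl, rfl | h⟩ := h
  · exact hx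
  · intro k hk
    have hp := h.perm
    have := hx k (by simpa [hp.mem_iff] using hk)
    simp only [pair_sublist_append, List.mem_append, hp.mem_iff] at this ⊢
    have := @LocalMove.pair_sublist _ _ h k
    tauto

theorem IsCocharge.mem_of_le {c : List ℕ} (hc : IsCocharge c) {j k : ℕ} (hk : k ∈ c)
    (hjk : j ≤ k) : j ∈ c := by
  induction k, hjk using Nat.le_induction with
  | base => exact hk
  | succ k _ ih => exact ih ((hc k hk).subset (by simp))

/-- Corotation of a letter `a` from the end of `y a` to its front, with a word `z` to the right that
stays in place. -/
theorem IsCocharge.corotate {y z : List ℕ} {a : ℕ} (h : IsCocharge (y ++ [a] ++ z))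
    (ha : a ∈ y ++ z) (hz : ∀ k ∈ z, k + 1 = a → [k + 1, k].Sublist z) :
    IsCocharge ((a + 1) :: (y ++ z)) := by
  intro k hk
  rw [pair_sublist_cons]
  rcases eq_or_ne k a with rfl | hka
  · exact Or.inr ⟨rfl, ha⟩
  · left
    have hk' : k + 1 ∈ y ++ [a] ++ z := by
      simp only [List.mem_cons, List.mem_append] at hk ⊢
      grind
    have := h k hk'
    simp only [pair_sublist_append, List.mem_append, List.mem_singleton] at this ⊢
    grind

/-- In a cocharge word, a letter `a > 0` occurs a second time, further to the left, if no `a - 1`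
stands to its right. -/
theorem IsCocharge.mem_of_append_singleton {y z : List ℕ} {a : ℕ}
    (h : IsCocharge (y ++ [a] ++ z)) (ha : 0 < a) (hz : a - 1 ∉ z) : a ∈ y := by
  have := h (a - 1) (by simp; omega)
  simp only [pair_sublist_append, List.mem_append, List.mem_singleton, Nat.sub_add_cancel ha]
    at this
  rcases this with ((h | h | h) | h | h)
  · exact h.subset (by simp)
  · exact absurd h (by simp)
  · omega
  · exact absurd (h.subset (by simp)) hz
  · exact absurd h.2 hz

/-- A corotation of a letter of non-zero label raises the label of that letter by one and keeps the
other labels. -/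
theorem IsLabeling.corotate {l : ℕ → ℕ} {w : List ℕ} {a : ℕ} (h : IsLabeling l (w ++ [a]))
    (ha : 0 < l a) : IsLabeling (Function.update l a (l a + 1)) (a :: w) := by
  obtain ⟨h1, h2⟩ := h
  rw [List.pairwise_append] at h1
  have hne : ∀ b ∈ w, b ≠ a := by
    intro b hb
    have := h1.2.2 b hb a (by simp)
    unfold LabelRel at this
    omega
  have hup : ∀ b ∈ w, Function.update l a (l a + 1) b = l b := fun b hb =>
    Function.update_of_ne (hne b hb) _ _
  have hmap : w.map (Function.update l a (l a + 1)) = w.map l := List.map_congr_left hup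
  constructor
  · rw [List.pairwise_cons]
    constructor
    · intro b hb
      have := h1.2.2 b hb a (by simp)
      unfold LabelRel at this ⊢
      rw [hup b hb, Function.update_self]
      omega
    · refine h1.1.imp_of_mem ?_
      intro b c hb hc hbc
      unfold LabelRel at hbc ⊢
      rwa [hup b hb, hup c hc]
  · rw [List.map_cons, Function.update_self, hmap]
    have h3 : IsCocharge (w.map l ++ [l a] ++ []) := by simpa using h2
    simpa using h3.corotate (by simpa using h3.mem_of_append_singleton ha (by simp)) (by simp)

/-- The position of letters in a word determines their relation. -/
theorem IsLabeling.labelRel {l : ℕ → ℕ} {w : List ℕ} (h : IsLabeling l w) {a b : ℕ}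
    (hb : b ∈ w) (hab : w.idxOf a < w.idxOf b) : LabelRel l a b := by
  have hb' := List.idxOf_lt_length_of_mem hb
  have := List.pairwise_iff_getElem.1 h.1 _ _ (hab.trans hb') hb' hab
  simpa using this

theorem nodup_of_pairwise_labelRel {l : ℕ → ℕ} {w : List ℕ} (h : w.Pairwise (LabelRel l)) :
    w.Nodup :=
  h.imp fun hab => by unfold LabelRel at hab; omega

theorem idxOf_lt_of_pair_sublist {w : List ℕ} (hw : w.Nodup) {a b : ℕ}
    (h : [a, b].Sublist w) : w.idxOf a < w.idxOf b := by
  induction w with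
  | nil => simp at h
  | cons c w ih =>
    rw [List.nodup_cons] at hw
    rw [pair_sublist_cons] at h
    have hb : b ≠ c := by
      rintro rfl
      rcases h with h | h
      · exact hw.1 (h.subset (by simp))
      · exact hw.1 h.2
    rcases h with h | h
    · have ha : a ≠ c := by
        rintro rfl
        exact hw.1 (h.subset (by simp))
      rw [List.idxOf_cons_ne _ ha.symm, List.idxOf_cons_ne _ hb.symm]
      exact Nat.succ_lt_succ (ih hw.2 h)
    · rw [List.idxOf_cons_ne _ hb.symm, h.1, List.idxOf_cons_self]
      omega

theorem pair_sublist_of_idxOf_lt {w : List ℕ} {a b : ℕ} (hb : b ∈ w)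
    (h : w.idxOf a < w.idxOf b) : [a, b].Sublist w := by
  induction w with
  | nil => simp at hb
  | cons c w ih =>
    rw [pair_sublist_cons]
    have hbc : b ≠ c := by
      rintro rfl
      simp at h
    have hb' : b ∈ w := by simpa [hbc] using hb
    rcases eq_or_ne a c with rfl | hac
    · exact Or.inr ⟨rfl, hb'⟩
    · rw [List.idxOf_cons_ne _ hac.symm, List.idxOf_cons_ne _ hbc.symm] at h
      exact Or.inl (ih hb' (by omega))

theorem IsCocharge.exists_idxOf {l : ℕ → ℕ} {w : List ℕ} (hw : w.Nodup)
    (h : IsCocharge (w.map l)) {k b : ℕ} (hb : b ∈ w) (hk : l b = k + 1) :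
    ∃ d e, d ∈ w ∧ e ∈ w ∧ w.idxOf d < w.idxOf e ∧ l d = k + 1 ∧ l e = k := by
  have := h k (List.mem_map.2 ⟨b, hb, hk⟩)
  rw [List.sublist_map_iff] at this
  obtain ⟨s, hs, he⟩ := this
  obtain ⟨d, e, rfl⟩ := List.length_eq_two.1 (by simpa using (congrArg List.length he).symm)
  simp only [List.map_cons, List.map_nil, List.cons.injEq, and_true] at he
  exact ⟨d, e, hs.subset (by simp), hs.subset (by simp), idxOf_lt_of_pair_sublist hw hs,
    he.1.symm, he.2.symm⟩

theorem IsStandardWord.mem_iff {n : ℕ} {w : List ℕ} (hw : IsStandardWord n w) (i : ℕ) :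
    i ∈ w ↔ 1 ≤ i ∧ i ≤ n := by
  rw [List.Perm.mem_iff hw, List.mem_range'_1]
  omega

theorem IsStandardWord.nodup {n : ℕ} {w : List ℕ} (hw : IsStandardWord n w) : w.Nodup :=
  (List.Perm.nodup_iff hw).2 List.nodup_range'

theorem cochargeLabel_succ (w : List ℕ) {i : ℕ} (hi : 1 ≤ i) :
    cochargeLabel w (i + 1) =
      if w.idxOf (i + 1) < w.idxOf i then cochargeLabel w i + 1 else cochargeLabel w i := by
  obtain ⟨i, rfl⟩ := Nat.exists_eq_add_of_le' hi
  rfl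

/-- A labeling of a standard word is its cocharge labeling. -/
theorem IsLabeling.cochargeLabel_eq {n : ℕ} {l : ℕ → ℕ} {w : List ℕ} (hw : IsStandardWord n w)
    (h : IsLabeling l w) {i : ℕ} (hi : 1 ≤ i) (hin : i ≤ n) : cochargeLabel w i = l i := by
  have hrel : ∀ {a b}, a ∈ w → b ∈ w → a ≠ b →
      (w.idxOf a < w.idxOf b ∧ LabelRel l a b) ∨ (w.idxOf b < w.idxOf a ∧ LabelRel l b a) := by
    intro a b ha hb hab
    rcases lt_trichotomy (w.idxOf a) (w.idxOf b) with h1 | h1 | h1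
    · exact Or.inl ⟨h1, h.labelRel hb h1⟩
    · exact absurd ((List.idxOf_inj ha).1 h1) hab
    · exact Or.inr ⟨h1, h.labelRel ha h1⟩
  unfold LabelRel at hrel
  induction i, hi using Nat.le_induction with
  | base =>
    rw [show cochargeLabel w 1 = 0 from rfl]
    by_contra hne
    have h1 : 1 ∈ w := (hw.mem_iff 1).2 ⟨le_rfl, hin⟩
    obtain ⟨d, e, hd, he, -, -, hle⟩ :=
      h.2.exists_idxOf hw.nodup h1 (k := l 1 - 1) (by omega)
    have := (hw.mem_iff e).1 he
    have hne : e ≠ 1 := by rintro rfl; omega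
    have := hrel he h1 hne
    omega
  | succ i hi ih =>
    have hi1 : i ∈ w := (hw.mem_iff i).2 ⟨hi, by omega⟩
    have hi2 : i + 1 ∈ w := (hw.mem_iff (i + 1)).2 ⟨by omega, hin⟩
    rw [cochargeLabel_succ w hi, ih (by omega)]
    have h12 := hrel hi1 hi2 (by omega)
    rcases Nat.eq_zero_or_pos (l (i + 1)) with h0 | h0
    · split_ifs <;> omega
    · obtain ⟨d, e, hd, he, hde, hld, hle⟩ :=
        h.2.exists_idxOf hw.nodup hi2 (k := l (i + 1) - 1) (by omega)
      -- a label between those of `i` and `i + 1` would belong to a letter between them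
      have hed : e ≠ i → _ := fun hne => hrel he hi1 hne
      have hed2 : e ≠ i + 1 → _ := fun hne => hrel he hi2 hne
      have hdi : d ≠ i → _ := fun hne => hrel hd hi1 hne
      have hdi2 : d ≠ i + 1 → _ := fun hne => hrel hd hi2 hne
      have e1 : e = i → w.idxOf e = w.idxOf i := fun h => by rw [h]
      have e2 : e = i → l e = l i := fun h => by rw [h]
      have e3 : d = i + 1 → w.idxOf d = w.idxOf (i + 1) := fun h => by rw [h]
      have e4 : e = i + 1 → l e = l (i + 1) := fun h => by rw [h]
      have e5 : d = i → l d = l i := fun h => by rw [h]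
      split_ifs with hpos
      · by_cases he1 : e = i
        · omega
        · have := hed he1
          by_cases he2 : e = i + 1
          · omega
          · have := hed2 he2
            omega
      · by_contra hne
        by_cases he1 : e = i
        · have := e1 he1
          have := e2 he1
          by_cases hd1 : d = i + 1
          · have := e3 hd1; omega
          · have := hdi2 hd1
            by_cases hd2 : d = i
            · omega
            · have := hdi hd2; omega
        · have := hed he1
          by_cases he2 : e = i + 1
          · omega
          · have := hed2 he2
            by_cases hd1 : d = i + 1
            · have := e3 hd1; omega
            · have := hdi2 hd1
              by_cases hd2 : d = i
              · omega
              · have := hdi hd2; omega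

theorem IsLabeling.cochargeLabeling_eq {n : ℕ} {l : ℕ → ℕ} {w : List ℕ}
    (hw : IsStandardWord n w) (h : IsLabeling l w) : cochargeLabeling w = w.map l :=
  List.map_congr_left fun i hi =>
    h.cochargeLabel_eq hw ((hw.mem_iff i).1 hi).1 ((hw.mem_iff i).1 hi).2

/-- Labels increase weakly with the numbers, and numbers with equal labels stand in increasing
order. -/
theorem cochargeLabel_mono (w : List ℕ) {a b : ℕ} (ha : 1 ≤ a) (hab : a ≤ b) :
    cochargeLabel w a ≤ cochargeLabel w b ∧
      (a < b → cochargeLabel w a = cochargeLabel w b → w.idxOf a ≤ w.idxOf b) := by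
  induction b, hab using Nat.le_induction with
  | base => simp
  | succ b hab ih =>
    rw [cochargeLabel_succ w (ha.trans hab)]
    rcases hab.eq_or_lt with rfl | hlt
    · split_ifs <;> omega
    · split_ifs <;> omega

theorem IsStandardWord.isLabeling {n : ℕ} {w : List ℕ} (hw : IsStandardWord n w) :
    IsLabeling (cochargeLabel w) w := by
  constructor
  · rw [List.pairwise_iff_getElem]
    intro i j hi hj hij
    have h1 := (hw.mem_iff _).1 (List.getElem_mem hi)
    have h2 := (hw.mem_iff _).1 (List.getElem_mem hj)
    have hI := hw.nodup.idxOf_getElem i hi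
    have hJ := hw.nodup.idxOf_getElem j hj
    have hne : w[i] ≠ w[j] := by
      intro h
      rw [h] at hI
      omega
    unfold LabelRel
    rcases hne.lt_or_gt with h | h
    · exact Or.inl ⟨h, (cochargeLabel_mono w h1.1 h.le).1⟩
    · right
      have := cochargeLabel_mono w h2.1 h.le
      refine ⟨h, this.1.lt_of_ne fun he => ?_⟩
      have := this.2 h he
      omega
  · intro k hk
    obtain ⟨b, hb, hbk⟩ := List.mem_map.1 hk
    have hb' := (hw.mem_iff b).1 hb
    -- descend from `b` to the smallest letter with the label `k + 1`
    have key : ∀ b, 1 ≤ b → b ≤ n → cochargeLabel w b = k + 1 →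
        ∃ i, 1 ≤ i ∧ i + 1 ≤ n ∧ cochargeLabel w i = k ∧ cochargeLabel w (i + 1) = k + 1 := by
      intro b hb
      induction b, hb using Nat.le_induction with
      | base => intro _ h; simp [cochargeLabel] at h
      | succ b hb ih =>
        intro hbn h
        have h' := cochargeLabel_succ w hb
        by_cases he : cochargeLabel w b = k + 1
        · exact ih (by omega) he
        · refine ⟨b, hb, hbn, ?_, h⟩
          split_ifs at h' <;> omega
    obtain ⟨i, hi, hin, h1, h2⟩ := key b hb'.1 hb'.2 hbk
    have h' := cochargeLabel_succ w hi
    have hlt : w.idxOf (i + 1) < w.idxOf i := by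
      by_contra hc
      rw [if_neg hc] at h'
      omega
    have := (pair_sublist_of_idxOf_lt ((hw.mem_iff i).2 ⟨hi, by omega⟩) hlt).map
      (cochargeLabel w)
    simpa [h1, h2] using this

/-! ### Standardization -/

/-- The rank of a letter in `w`, the number of letters that are at most as large, is strictly
increasing. -/
theorem rank_strictMono {w : List ℕ} {a b : ℕ} (hb : b ∈ w) (hab : a < b) :
    w.countP (· ≤ a) < w.countP (· ≤ b) := by
  induction w with
  | nil => simp at hb
  | cons c w ih =>
    have hle : w.countP (· ≤ a) ≤ w.countP (· ≤ b) :=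
      List.countP_mono_left fun x _ hx => by simp at hx ⊢; omega
    simp only [List.countP_cons, decide_eq_true_eq]
    rcases List.mem_cons.1 hb with rfl | hb
    · split_ifs <;> omega
    · have := ih hb
      split_ifs <;> omega

/-- A cocharge word is the cocharge labeling of a standard word. -/
theorem IsCocharge.exists_standardWord {c : List ℕ} (hc : IsCocharge c) :
    ∃ w, IsStandardWord c.length w ∧ cochargeLabeling w = c := by
  -- letter and position are encoded in a number, and the numbers are replaced by their ranks
  set n := c.length with hn
  let key : ℕ × ℕ → ℕ := fun p => p.1 * n + p.2
  let W := c.zipIdx.map key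
  have hsnd : ∀ p ∈ c.zipIdx, p.2 < n := by
    rintro ⟨a, i⟩ hp
    have := List.snd_lt_of_mem_zipIdx hp
    simpa using this
  have hdiv : ∀ p ∈ c.zipIdx, key p / n = p.1 := by
    intro p hp
    have h1 := hsnd p hp
    rw [show key p = p.2 + n * p.1 by simp only [key]; ring,
      Nat.add_mul_div_left _ _ (by omega), Nat.div_eq_of_lt h1, zero_add]
  have hWl : W.map (· / n) = c := by
    rw [List.map_map]
    conv_rhs => rw [← List.zipIdx_map_fst 0 c]
    exact List.map_congr_left hdiv
  have hW : W.Pairwise (LabelRel (· / n)) := by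
    rw [List.pairwise_iff_getElem]
    intro i j hi hj hij
    simp only [W, List.length_map, List.length_zipIdx] at hi hj
    have h1 := hdiv _ (List.getElem_mem (l := c.zipIdx) (n := i) (by simpa using hi))
    have h2 := hdiv _ (List.getElem_mem (l := c.zipIdx) (n := j) (by simpa using hj))
    simp only [W, List.getElem_map, LabelRel, h1, h2]
    simp only [List.getElem_zipIdx, key, zero_add]
    rcases le_or_gt ((c)[i]) ((c)[j]) with h | h
    · have := Nat.mul_le_mul_right n h
      omega
    · have := Nat.mul_le_mul_right n (Nat.succ_le_of_lt h)
      rw [Nat.succ_mul] at this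
      omega
  let rank : ℕ → ℕ := fun a => W.countP (· ≤ a)
  have hmono : ∀ a ∈ W, ∀ b ∈ W, (a < b ↔ rank a < rank b) := by
    intro a ha b hb
    refine ⟨rank_strictMono hb, fun h => ?_⟩
    rcases lt_trichotomy a b with h' | rfl | h'
    · exact h'
    · omega
    · have : rank b < rank a := rank_strictMono ha h'
      omega
  have hinj : Set.InjOn rank {a | a ∈ W} := by
    intro a ha b hb hab
    have h1 := hmono a ha b hb
    have h2 := hmono b hb a ha
    omega
  have hlen : W.length = n := by simp [W, hn]
  let l : ℕ → ℕ := fun r => Function.invFunOn rank {a | a ∈ W} r / n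
  have hl : ∀ a ∈ W, l (rank a) = a / n := by
    intro a ha
    simp only [l]
    rw [hinj.leftInvOn_invFunOn ha]
  have hmap : (W.map rank).map l = c := by
    conv_rhs => rw [← hWl]
    rw [List.map_map]
    exact List.map_congr_left hl
  have hpw : (W.map rank).Pairwise (LabelRel l) := by
    rw [List.pairwise_map]
    refine hW.imp_of_mem ?_
    intro a b ha hb hab
    unfold LabelRel at hab ⊢
    rwa [hl a ha, hl b hb, ← hmono a ha b hb, ← hmono b hb a ha]
  have hstd : IsStandardWord n (W.map rank) := by
    have hnd := nodup_of_pairwise_labelRel hpw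
    refine (hnd.subperm ?_).perm_of_length_le (by simp [hlen])
    intro r hr
    obtain ⟨a, ha, rfl⟩ := List.mem_map.1 hr
    have h1 : 0 < rank a := List.countP_pos_iff.2 ⟨a, ha, by simp⟩
    have h2 : rank a ≤ W.length := List.countP_le_length
    rw [List.mem_range'_1]
    omega
  exact ⟨W.map rank, hstd, by
    rw [IsLabeling.cochargeLabeling_eq hstd ⟨hpw, by rwa [hmap]⟩, hmap]⟩

/-! ### Knuth equivalence -/

theorem LabelRel.le_of_lt {l : ℕ → ℕ} {a b : ℕ} (h : LabelRel l a b) (hab : a < b) :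
    l a ≤ l b := by
  unfold LabelRel at h; omega

theorem LabelRel.lt_of_gt {l : ℕ → ℕ} {a b : ℕ} (h : LabelRel l a b) (hab : b < a) :
    l b < l a := by
  unfold LabelRel at h; omega

theorem pairwise_append_three {R : ℕ → ℕ → Prop} {p t q : List ℕ} :
    (p ++ t ++ q).Pairwise R ↔ p.Pairwise R ∧ t.Pairwise R ∧ q.Pairwise R ∧
      (∀ a ∈ p, ∀ b ∈ t, R a b) ∧ (∀ a ∈ p, ∀ b ∈ q, R a b) ∧ (∀ a ∈ t, ∀ b ∈ q, R a b) := by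
  simp only [List.pairwise_append, List.mem_append]
  grind

/-- Replacing a factor by a rearrangement, so that the labels change by a local move. -/
theorem IsLabeling.of_localMove {l : ℕ → ℕ} {p t t' q : List ℕ} (h : IsLabeling l (p ++ t ++ q))
    (hp : t.Perm t') (hm : LocalMove (t.map l) (t'.map l)) (ht' : t'.Pairwise (LabelRel l)) :
    WordMove ((p ++ t ++ q).map l) ((p ++ t' ++ q).map l) ∧ IsLabeling l (p ++ t' ++ q) := by
  have hw : WordMove ((p ++ t ++ q).map l) ((p ++ t' ++ q).map l) :=
    ⟨p.map l, q.map l, _, _, by simp, by simp, Or.inr hm⟩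
  refine ⟨hw, ?_, h.2.of_wordMove hw⟩
  have := h.1
  rw [pairwise_append_three] at this ⊢
  simp only [hp.mem_iff] at this
  tauto

/-- A catabolism transformation keeps the labels of all letters. -/
theorem IsLabeling.swap {l : ℕ → ℕ} {p q : List ℕ} {a b : ℕ}
    (h : IsLabeling l (p ++ [a, b] ++ q)) (hab : l a + 1 < l b ∨ l b + 1 < l a) :
    WordMove ((p ++ [a, b] ++ q).map l) ((p ++ [b, a] ++ q).map l) ∧
      IsLabeling l (p ++ [b, a] ++ q) := by
  refine h.of_localMove (.swap _ _ _) (.swap _ _ hab) ?_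
  have := (pairwise_append_three.1 h.1).2.1
  simp [LabelRel] at this ⊢
  omega

/-- A Knuth move on letters either swaps labels that differ by more than one or is a Knuth move on
two consecutive labels. -/
theorem IsLabeling.knuth {l : ℕ → ℕ} {u v : List ℕ} (h : IsLabeling l u)
    (hk : IsKnuthTransformation u v) : WordMove (u.map l) (v.map l) ∧ IsLabeling l v := by
  obtain ⟨p, q, a, b, c, hab, hbc, ⟨rfl, rfl⟩ | ⟨rfl, rfl⟩ | ⟨rfl, rfl⟩ | ⟨rfl, rfl⟩⟩ := hk
  all_goals
    have ht := (pairwise_append_three.1 h.1).2.1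
    simp only [List.pairwise_cons, List.mem_cons, List.not_mem_nil, or_false, forall_eq_or_imp,
      forall_eq, LabelRel, false_imp_iff, implies_true, and_true, List.Pairwise.nil] at ht
    rcases Nat.lt_or_ge (l a + 1) (l c) with hac | hac
  · have := IsLabeling.swap (p := p ++ [b]) (q := q) (a := a) (b := c) (by simpa using h)
      (Or.inl hac)
    simpa using this
  · refine h.of_localMove (.cons _ (.swap _ _ _)) ?_ ?_
    · have h1 : l b = l a + 1 := by omega
      have h2 : l c = l a + 1 := by omega
      simpa [h1, h2] using LocalMove.bab (l a)
    · simp [LabelRel]; omega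
  · have := IsLabeling.swap (p := p ++ [b]) (q := q) (a := c) (b := a) (by simpa using h)
      (Or.inr hac)
    simpa using this
  · refine h.of_localMove (.cons _ (.swap _ _ _)) ?_ ?_
    · have h1 : l b = l a + 1 := by omega
      have h2 : l c = l a + 1 := by omega
      simpa [h1, h2] using LocalMove.bba (l a)
    · simp [LabelRel]; omega
  · have := IsLabeling.swap (p := p) (q := b :: q) (a := a) (b := c) (by simpa using h)
      (Or.inl hac)
    simpa using this
  · refine h.of_localMove (.swap _ _ _) ?_ ?_
    · have h1 : l b = l a := by omega
      have h2 : l c = l a + 1 := by omega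
      simpa [h1, h2] using LocalMove.aba (l a)
    · simp [LabelRel]; omega
  · have := IsLabeling.swap (p := p) (q := b :: q) (a := c) (b := a) (by simpa using h)
      (Or.inr hac)
    simpa using this
  · refine h.of_localMove (.swap _ _ _) ?_ ?_
    · have h1 : l b = l a := by omega
      have h2 : l c = l a + 1 := by omega
      simpa [h1, h2] using LocalMove.baa (l a)
    · simp [LabelRel]; omega

/-- Knuth equivalence of words. -/
def KnuthEquiv : List ℕ → List ℕ → Prop :=
  Relation.ReflTransGen IsKnuthTransformation

theorem KnuthEquiv.trans {u v w : List ℕ} (h : KnuthEquiv u v) (h' : KnuthEquiv v w) :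
    KnuthEquiv u w :=
  Relation.ReflTransGen.trans h h'

theorem IsKnuthTransformation.knuthEquiv {u v : List ℕ} (h : IsKnuthTransformation u v) :
    KnuthEquiv u v :=
  .single h

theorem IsKnuthTransformation.append {u v : List ℕ} (h : IsKnuthTransformation u v)
    (s t : List ℕ) : IsKnuthTransformation (s ++ u ++ t) (s ++ v ++ t) := by
  obtain ⟨p, q, a, b, c, hab, hbc, h⟩ := h
  refine ⟨s ++ p, q ++ t, a, b, c, hab, hbc, ?_⟩
  rcases h with ⟨rfl, rfl⟩ | ⟨rfl, rfl⟩ | ⟨rfl, rfl⟩ | ⟨rfl, rfl⟩ <;> simp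

theorem KnuthEquiv.append {u v : List ℕ} (h : KnuthEquiv u v) (s t : List ℕ) :
    KnuthEquiv (s ++ u ++ t) (s ++ v ++ t) :=
  by
  refine Relation.ReflTransGen.lift (fun x => s ++ x ++ t) ?_ _ _ h
  exact fun _ _ h => h.append s t

theorem KnuthEquiv.perm {u v : List ℕ} (h : KnuthEquiv u v) : u.Perm v := by
  induction h with
  | refl => exact .refl _
  | tail _ h ih =>
    refine ih.trans ?_
    obtain ⟨p, q, a, b, c, hab, hbc, h⟩ := h
    rcases h with ⟨rfl, rfl⟩ | ⟨rfl, rfl⟩ | ⟨rfl, rfl⟩ | ⟨rfl, rfl⟩ <;>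
      refine .append_right _ (.append_left _ ?_)
    · exact .cons _ (.swap _ _ _)
    · exact .cons _ (.swap _ _ _)
    · exact .swap _ _ _
    · exact .swap _ _ _

theorem IsKnuthTransformation.symm {u v : List ℕ} (h : IsKnuthTransformation u v) :
    IsKnuthTransformation v u := by
  obtain ⟨p, q, a, b, c, hab, hbc, h⟩ := h
  exact ⟨p, q, a, b, c, hab, hbc, by tauto⟩

/-- Knuth equivalent words have the same labels of their letters, and the same output. -/
theorem IsLabeling.knuthEquiv {l : ℕ → ℕ} {u v : List ℕ} (h : IsLabeling l u)
    (hk : KnuthEquiv u v) : IsLabeling l v ∧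
      ∀ mu, HasOutput (v.map l, []) mu → HasOutput (u.map l, []) mu := by
  induction hk with
  | refl => exact ⟨h, fun _ => id⟩
  | tail _ hk ih =>
    have h1 := ih.1.knuth hk
    have h2 := h1.2.knuth hk.symm
    exact ⟨h1.2, fun mu hmu => ih.2 mu (h2.1.hasOutput isPartition_nil hmu)⟩

/-! ### Row insertion -/

theorem mem_rowInsert {r : List ℕ} {a b : ℕ} (h : (rowInsert r a).2 = some b) : b ∈ r ∧ a < b := by
  induction r with
  | nil => simp [rowInsert] at h
  | cons c r ih =>
    simp only [rowInsert] at h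
    split_ifs at h with hac
    · simp only [Option.some.injEq] at h
      subst h
      exact ⟨by simp, hac⟩
    · have := ih h
      exact ⟨by simp [this.1], this.2⟩

/-- The inserted letter `a` can be moved to the left, past the letters greater than the bumped
letter `b`. -/
theorem knuthEquiv_insert_left {r : List ℕ} {a b : ℕ} (hab : a < b)
    (hr : (b :: r).Pairwise (· < ·)) : KnuthEquiv (b :: r ++ [a]) (b :: a :: r) := by
  induction r using List.reverseRecOn with
  | nil => exact .refl
  | append_singleton r c ih =>
    have hr' : (b :: r).Pairwise (· < ·) := by
      rw [← List.cons_append, List.pairwise_append] at hr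
      exact hr.1
    -- `x c a` becomes `x a c`, where `x` is the letter to the left of `c`
    obtain ⟨s, x, hx⟩ : ∃ s x, b :: r = s ++ [x] := by
      rcases List.eq_nil_or_concat (b :: r) with h | ⟨s, x, h⟩
      · simp at h
      · exact ⟨s, x, by simpa using h⟩
    have hxc : x < c := by
      rw [← List.cons_append, List.pairwise_append] at hr
      exact hr.2.2 x (by simp [hx]) c (by simp)
    have hax : a < x := by
      have hm : x ∈ b :: r := by simp [hx]
      rcases List.mem_cons.1 hm with rfl | hm
      · exact hab
      · exact hab.trans ((List.pairwise_cons.1 hr').1 x hm)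
    have h1 : IsKnuthTransformation (b :: (r ++ [c]) ++ [a]) (b :: r ++ [a] ++ [c]) := by
      rw [← List.cons_append, hx]
      exact ⟨s, [], a, x, c, hax, hxc, Or.inr (Or.inl ⟨by simp, by simp⟩)⟩
    have h2 := (ih hr').append [] [c]
    simpa using h1.knuthEquiv.trans (by simpa using h2)

/-- The bumped letter `b` can be moved to the front, past the letters smaller than the inserted
letter `a`. -/
theorem knuthEquiv_bump_left {p t : List ℕ} {a b : ℕ} (hab : a < b)
    (hp : (p ++ [a]).Pairwise (· < ·)) : KnuthEquiv (p ++ [b, a] ++ t) (b :: (p ++ [a] ++ t)) := by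
  induction p using List.reverseRecOn generalizing a t with
  | nil => exact .refl
  | append_singleton p c ih =>
    have hca : c < a := by
      rw [List.pairwise_append] at hp
      exact hp.2.2 c (by simp) a (by simp)
    have hp' : (p ++ [c]).Pairwise (· < ·) := (List.pairwise_append.1 hp).1
    -- `c b a` becomes `b c a`
    have h1 : IsKnuthTransformation (p ++ [c] ++ [b, a] ++ t) (p ++ [b, c] ++ (a :: t)) :=
      ⟨p, t, c, a, b, hca, hab, Or.inr (Or.inr (Or.inl ⟨by simp, by simp⟩))⟩
    simpa using h1.knuthEquiv.trans (ih (t := a :: t) (hca.trans hab) hp')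

/-- Row insertion of `a` into a row `r` from which `b` is bumped, as a Knuth equivalence. -/
theorem rowInsert_knuthEquiv {r : List ℕ} {a b : ℕ} (hr : r.Pairwise (· < ·)) (ha : a ∉ r)
    (h : (rowInsert r a).2 = some b) : KnuthEquiv (r ++ [a]) (b :: (rowInsert r a).1) := by
  -- `p` collects the letters smaller than `a` that have been passed
  suffices key : ∀ p : List ℕ, (p ++ r).Pairwise (· < ·) → (∀ x ∈ p, x < a) →
      KnuthEquiv (p ++ r ++ [a]) (b :: (p ++ (rowInsert r a).1)) by
    simpa using key [] (by simpa using hr) (by simp)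
  induction r with
  | nil => simp [rowInsert] at h
  | cons c r ih =>
    intro p hp hpa
    simp only [rowInsert] at h ⊢
    simp only [List.mem_cons, not_or] at ha
    split_ifs at h ⊢ with hac
    · simp only [Option.some.injEq] at h
      subst h
      have h1 := (knuthEquiv_insert_left hac hr).append p []
      have h2 : (p ++ [a]).Pairwise (· < ·) := by
        rw [List.pairwise_append] at hp ⊢
        exact ⟨hp.1, by simp, by simpa using hpa⟩
      have h3 := knuthEquiv_bump_left (t := r) hac h2
      exact KnuthEquiv.trans (by simpa using h1) (by simpa using h3)
    · have := ih hr.of_cons ha.2 h (p ++ [c]) (by simpa using hp) (by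
        intro x hx
        rcases List.mem_append.1 hx with hx | hx
        · exact hpa x hx
        · rw [List.mem_singleton.1 hx]
          omega)
      simpa using this

theorem rowInsert_none {r : List ℕ} {a : ℕ} (h : (rowInsert r a).2 = none) :
    (rowInsert r a).1 = r ++ [a] := by
  induction r with
  | nil => rfl
  | cons c r ih =>
    simp only [rowInsert] at h ⊢
    split_ifs at h ⊢
    rw [ih h]
    rfl

theorem mem_of_mem_rowInsert {r : List ℕ} {a x : ℕ} (h : x ∈ (rowInsert r a).1) :
    x ∈ r ∨ x = a := by
  induction r with
  | nil => simpa [rowInsert] using h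
  | cons c r ih =>
    simp only [rowInsert] at h
    split_ifs at h <;> grind

theorem pairwise_rowInsert {r : List ℕ} {a : ℕ} (hr : r.Pairwise (· < ·)) (ha : a ∉ r) :
    (rowInsert r a).1.Pairwise (· < ·) := by
  induction r with
  | nil => simp [rowInsert]
  | cons c r ih =>
    simp only [List.mem_cons, not_or] at ha
    rw [List.pairwise_cons] at hr
    simp only [rowInsert]
    split_ifs with hac
    · exact List.pairwise_cons.2 ⟨fun x hx => hac.trans (hr.1 x hx), hr.2⟩
    · refine List.pairwise_cons.2 ⟨fun x hx => ?_, ih hr.2 ha.2⟩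
      rcases mem_of_mem_rowInsert hx with hx | rfl
      · exact hr.1 x hx
      · omega

/-! ### Insertion tableaux -/

/-- The row `s` fits below the row `r`: it is not longer, and each of its entries is greater than
the entry of `r` above it. -/
def FitsBelow : List ℕ → List ℕ → Prop
  | _, [] => True
  | [], _ :: _ => False
  | x :: r, y :: s => x < y ∧ FitsBelow r s

/-- Rows increase from left to right, and columns increase from top to bottom. -/
def IsTableau : List (List ℕ) → Prop
  | [] => True
  | r :: T => r.Pairwise (· < ·) ∧ FitsBelow r (T.headD []) ∧ IsTableau T

theorem fitsBelow_nil (r : List ℕ) : FitsBelow r [] := by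
  cases r <;> trivial

theorem FitsBelow.rowInsert_left {r s : List ℕ} (h : FitsBelow r s) (a : ℕ) :
    FitsBelow (rowInsert r a).1 s := by
  induction r generalizing s with
  | nil =>
    cases s with
    | nil => trivial
    | cons y s => exact absurd h (by simp [FitsBelow])
  | cons x r ih =>
    cases s with
    | nil => exact fitsBelow_nil _
    | cons y s =>
      simp only [rowInsert]
      split_ifs with hax
      · exact ⟨hax.trans h.1, h.2⟩
      · exact ⟨h.1, ih h.2⟩

/-- Inserting the bumped letter into the next row preserves the columns. -/
theorem FitsBelow.rowInsert {r s : List ℕ} (h : FitsBelow r s) {a b : ℕ}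
    (hb : (rowInsert r a).2 = some b) :
    FitsBelow (CatabolismInsertion.rowInsert r a).1 (CatabolismInsertion.rowInsert s b).1 := by
  induction r generalizing s with
  | nil => simp [CatabolismInsertion.rowInsert] at hb
  | cons x r ih =>
    have hab := (mem_rowInsert hb).2
    simp only [CatabolismInsertion.rowInsert] at hb ⊢
    split_ifs at hb ⊢ with hax
    · simp only [Option.some.injEq] at hb
      subst hb
      cases s with
      | nil => exact ⟨hax, fitsBelow_nil _⟩
      | cons y s =>
        rw [CatabolismInsertion.rowInsert, if_pos h.1]
        exact ⟨hax, h.2⟩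
    · cases s with
      | nil => exact ⟨by omega, fitsBelow_nil _⟩
      | cons y s =>
        simp only [CatabolismInsertion.rowInsert]
        split_ifs with hby
        · exact ⟨by omega, h.2.rowInsert_left a⟩
        · exact ⟨h.1, ih h.2 hb⟩

theorem rowWord_cons (r : List ℕ) (T : List (List ℕ)) : rowWord (r :: T) = rowWord T ++ r := by
  simp [rowWord]

theorem headD_tableauInsert (T : List (List ℕ)) (a : ℕ) :
    (tableauInsert T a).headD [] = (rowInsert (T.headD []) a).1 := by
  cases T with
  | nil => rfl
  | cons r T =>
    simp only [tableauInsert, List.headD_cons]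
    split <;> simp [*]

theorem isTableau_tableauInsert {T : List (List ℕ)} (hT : IsTableau T) {a : ℕ}
    (hnd : (rowWord T ++ [a]).Nodup) :
    IsTableau (tableauInsert T a) ∧
      KnuthEquiv (rowWord T ++ [a]) (rowWord (tableauInsert T a)) := by
  induction T generalizing a with
  | nil =>
    exact ⟨⟨by simp, fitsBelow_nil _, trivial⟩, .refl⟩
  | cons r T ih =>
    obtain ⟨hr, hf, hT⟩ := hT
    rw [rowWord_cons] at hnd ⊢
    have har : a ∉ r := by
      simp only [List.nodup_append, List.mem_append, List.mem_singleton] at hnd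
      exact fun h => hnd.2.2 a (Or.inr h) a rfl rfl
    have hr' := pairwise_rowInsert hr har
    simp only [tableauInsert]
    split
    · rename_i r' h
      have h2 : (rowInsert r a).2 = none := by rw [h]
      have h1 := rowInsert_none h2
      have hm := hf.rowInsert_left a
      rw [h] at h1 hr' hm
      simp only at h1 hr' hm
      refine ⟨⟨hr', hm, hT⟩, ?_⟩
      rw [rowWord_cons, h1, List.append_assoc]
      exact .refl
    · rename_i r' b h
      have h2 : (rowInsert r a).2 = some b := by rw [h]
      have hk := rowInsert_knuthEquiv hr har h2
      have hm := hf.rowInsert h2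
      have hbr := (mem_rowInsert h2).1
      rw [← headD_tableauInsert] at hm
      rw [h] at hk hr' hm
      have hnd' : (rowWord T ++ [b]).Nodup := by
        simp only [List.nodup_append, List.mem_append, List.mem_singleton] at hnd ⊢
        exact ⟨hnd.1.1, by simp, fun x hx y hy => hnd.1.2.2 x hx y (hy ▸ hbr)⟩
      have hi := ih hT hnd'
      refine ⟨⟨hr', hm, hi.1⟩, ?_⟩
      rw [rowWord_cons]
      have h3 := hk.append (rowWord T) []
      have h4 := hi.2.append [] r'
      exact KnuthEquiv.trans (by simpa using h3) (by simpa using h4)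

theorem insertionTableau_append_singleton (w : List ℕ) (a : ℕ) :
    insertionTableau (w ++ [a]) = tableauInsert (insertionTableau w) a := by
  simp [insertionTableau]

/-- A word with distinct letters is Knuth equivalent to the row reading word of its insertion
tableau. -/
theorem insertionTableau_spec {w : List ℕ} (hw : w.Nodup) :
    IsTableau (insertionTableau w) ∧ KnuthEquiv w (rowWord (insertionTableau w)) := by
  induction w using List.reverseRecOn with
  | nil => exact ⟨trivial, .refl⟩
  | append_singleton w a ih =>
    have hi := ih (List.nodup_append.1 hw).1
    rw [insertionTableau_append_singleton]
    have h1 := hi.2.append [] [a]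
    simp only [List.nil_append] at h1
    have h2 := isTableau_tableauInsert hi.1 (h1.perm.nodup_iff.1 hw)
    exact ⟨h2.1, h1.trans h2.2⟩

/-! ### Labels in a tableau -/

theorem FitsBelow.exists_lt {r s : List ℕ} (h : FitsBelow r s) {y : ℕ} (hy : y ∈ s) :
    ∃ x ∈ r, x < y := by
  induction r generalizing s with
  | nil =>
    cases s with
    | nil => simp at hy
    | cons z s => exact absurd h (by simp [FitsBelow])
  | cons x r ih =>
    cases s with
    | nil => simp at hy
    | cons z s =>
      rcases List.mem_cons.1 hy with rfl | hy
      · exact ⟨x, by simp, h.1⟩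
      · obtain ⟨x', hx', hlt⟩ := ih h.2 hy
        exact ⟨x', by simp [hx'], hlt⟩

theorem IsTableau.exists_lt {R : List ℕ} {T : List (List ℕ)} (h : IsTableau (R :: T)) {y : ℕ}
    (hy : y ∈ rowWord T) : ∃ x ∈ R, x < y := by
  induction T generalizing R y with
  | nil => simp [rowWord] at hy
  | cons S T ih =>
    obtain ⟨-, hf, hT⟩ := h
    rw [rowWord_cons, List.mem_append] at hy
    rcases hy with hy | hy
    · obtain ⟨x, hx, hxy⟩ := ih hT hy
      obtain ⟨z, hz, hzx⟩ := hf.exists_lt hx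
      exact ⟨z, hz, hzx.trans hxy⟩
    · exact hf.exists_lt hy

theorem FitsBelow.countP_le {r s : List ℕ} (h : FitsBelow r s) {l : ℕ → ℕ}
    (hl : ∀ y ∈ s, ∀ x ∈ r, x < y → l x < l y) :
    s.countP (l · = 1) ≤ r.countP (l · = 0) := by
  induction r generalizing s with
  | nil =>
    cases s with
    | nil => simp
    | cons z s => exact absurd h (by simp [FitsBelow])
  | cons x r ih =>
    cases s with
    | nil => simp
    | cons y s =>
      have h1 := hl y (by simp) x (by simp) h.1
      have h2 := ih h.2 fun y hy x hx => hl y (by simp [hy]) x (by simp [hx])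
      simp only [List.countP_cons, decide_eq_true_eq]
      split_ifs <;> omega

/-- Labels strictly increase down the columns of a tableau. -/
theorem IsLabeling.lt_of_rowWord {l : ℕ → ℕ} {R : List ℕ} {T : List (List ℕ)}
    (h : IsLabeling l (rowWord (R :: T))) {x y : ℕ} (hy : y ∈ rowWord T) (hx : x ∈ R)
    (hxy : x < y) : l x < l y := by
  rw [rowWord_cons, IsLabeling, List.pairwise_append] at h
  exact (h.1.2.2 y hy x hx).lt_of_gt hxy

theorem IsLabeling.pos_of_rowWord {l : ℕ → ℕ} {R : List ℕ} {T : List (List ℕ)}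
    (h : IsLabeling l (rowWord (R :: T))) (hT : IsTableau (R :: T)) {y : ℕ}
    (hy : y ∈ rowWord T) : 0 < l y := by
  obtain ⟨x, hx, hxy⟩ := hT.exists_lt hy
  have := h.lt_of_rowWord hy hx hxy
  omega

/-- Below the first row, the label `1` occurs at most as often as the label `0` in the first row. -/
theorem IsLabeling.countP_rowWord_le {l : ℕ → ℕ} {R : List ℕ} {T : List (List ℕ)}
    (h : IsLabeling l (rowWord (R :: T))) (hT : IsTableau (R :: T)) :
    (rowWord T).countP (l · = 1) ≤ R.countP (l · = 0) := by
  cases T with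
  | nil => simp [rowWord]
  | cons S T =>
    have h0 : (rowWord T).countP (l · = 1) = 0 := by
      rw [List.countP_eq_zero]
      intro y hy
      obtain ⟨x, hx, hxy⟩ := hT.2.2.exists_lt hy
      have h1 := h.pos_of_rowWord hT (y := x) (by simp [rowWord_cons, hx])
      have h2 : l x < l y := by
        have := h.1
        rw [rowWord_cons, List.pairwise_append, rowWord_cons, List.pairwise_append] at this
        exact (this.1.2.2 y hy x hx).lt_of_gt hxy
      simp only [decide_eq_true_eq]
      omega
    rw [rowWord_cons, List.countP_append, h0, zero_add]
    exact hT.2.1.countP_le fun y hy x hx hxy =>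
      h.lt_of_rowWord (by simp only [rowWord_cons, List.mem_append]; exact Or.inr hy) hx hxy

/-- If the labels increase weakly along a row, those equal to `0` form an initial segment. -/
theorem exists_split {l : ℕ → ℕ} {R : List ℕ} (h : R.Pairwise (fun a b => l a ≤ l b)) :
    ∃ k ≤ R.length, (∀ a ∈ R.take k, l a = 0) ∧ (∀ a ∈ R.drop k, 0 < l a) := by
  induction R with
  | nil => exact ⟨0, by simp⟩
  | cons x R ih =>
    rw [List.pairwise_cons] at h
    rcases Nat.eq_zero_or_pos (l x) with hx | hx
    · obtain ⟨k, hk, h1, h2⟩ := ih h.2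
      exact ⟨k + 1, by simpa using hk, by simpa [hx] using h1, by simpa using h2⟩
    · exact ⟨0, by simp, by simp, by simpa [hx] using fun a ha => hx.trans_le (h.1 a ha)⟩

/-! ### Comparison of runs of the algorithm -/

theorem pass_of_pos {t : List ℕ} (ht : ∀ a ∈ t, 0 < a) : pass t [] = (t.map (· + 1), []) := by
  induction t with
  | nil => rfl
  | cons a t ih =>
    have ha : 0 < a := ht a (by simp)
    have : ¬ IsPartition (addUnit [] a) := by
      rw [isPartition_addUnit_iff isPartition_nil]
      simp
      omega
    simp [pass, ih fun b hb => ht b (by simp [hb]), this]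

theorem pass_replicate_zero (k : ℕ) : pass (List.replicate (k + 1) 0) [] = ([], [k + 1]) := by
  induction k with
  | zero => simp [pass, addUnit, IsPartition]
  | succ k ih =>
    rw [List.replicate_succ, pass, ih]
    simp [addUnit, IsPartition]

/-- The run on a word with `ν` agrees with the run on the word raised by one, below a first row of
length `k`, as long as `k` is so large that the letters `0` can be inserted in the second row. -/
theorem HasOutput.cons {x nu mu : List ℕ} {k : ℕ} (h : HasOutput (x, nu) mu)
    (hnu : IsPartition nu) (hk : 0 < k) (hx : nu.getD 0 0 + x.count 0 ≤ k) :
    HasOutput (x.map (· + 1), k :: nu) (k :: mu) := by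
  obtain ⟨j, hj⟩ := h
  induction j generalizing x nu with
  | zero =>
    obtain ⟨rfl, rfl⟩ := Prod.mk.inj hj
    exact ⟨0, rfl⟩
  | succ j ih =>
    rcases List.eq_nil_or_concat x with rfl | ⟨y, a, rfl⟩
    · rw [iterate_step_nil] at hj
      obtain ⟨-, rfl⟩ := Prod.mk.inj hj
      exact ⟨0, rfl⟩
    · rw [List.concat_eq_append] at hj hx ⊢
      rw [List.count_append, List.count_singleton] at hx
      rw [Function.iterate_succ_apply, step_append_singleton] at hj
      rw [List.map_append, List.map_singleton, ← hasOutput_iterate 1, Function.iterate_one,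
        step_append_singleton, addUnit]
      split_ifs at hj with ha
      · have hle : (addUnit nu a).getD 0 0 + y.count 0 ≤ k := by
          rw [getD_addUnit]
          simp only [beq_iff_eq] at hx
          split_ifs at hx ⊢ <;> omega
        rw [if_pos ((isPartition_cons _ _).2 ⟨hk, by omega, ha⟩)]
        exact ih ha hle hj
      · rw [if_neg fun h => ha ((isPartition_cons _ _).1 h).2.2]
        exact ih hnu (by rw [List.count_cons_of_ne (by simp)]; omega) hj

/-- A corotated letter was not `0`, since `0` can always be inserted. -/
theorem two_le_of_mem_pass {t nu : List ℕ} (hnu : IsPartition nu) {a : ℕ}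
    (ha : a ∈ (pass t nu).1) : 2 ≤ a := by
  induction t with
  | nil => simp [pass] at ha
  | cons b t ih =>
    simp only [pass] at ha
    split_ifs at ha with hb
    · exact ih ha
    · rcases List.mem_cons.1 ha with rfl | ha
      · rw [isPartition_addUnit_iff (isPartition_pass hnu t)] at hb
        omega
      · exact ih ha

/-- The length of the first row does not matter for a word without the letters `0` and `1`. -/
theorem HasOutput.addUnit_zero {x nu mu : List ℕ} (h : HasOutput (x, nu) mu)
    (hnu : IsPartition nu) (hx : ∀ a ∈ x, 2 ≤ a) :
    HasOutput (x, addUnit nu 0) (addUnit mu 0) := by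
  obtain ⟨j, hj⟩ := h
  induction j generalizing x nu with
  | zero =>
    obtain ⟨rfl, rfl⟩ := Prod.mk.inj hj
    exact ⟨0, rfl⟩
  | succ j ih =>
    rcases List.eq_nil_or_concat x with rfl | ⟨y, a, rfl⟩
    · rw [iterate_step_nil] at hj
      obtain ⟨-, rfl⟩ := Prod.mk.inj hj
      exact ⟨0, rfl⟩
    · rw [List.concat_eq_append] at hj hx ⊢
      have ha2 := hx a (by simp)
      have hnu0 : IsPartition (addUnit nu 0) := (isPartition_addUnit_iff hnu 0).2 (Or.inl rfl)
      have hiff : IsPartition (addUnit (addUnit nu 0) a) ↔ IsPartition (addUnit nu a) := by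
        rw [isPartition_addUnit_iff hnu0, isPartition_addUnit_iff hnu, getD_addUnit, getD_addUnit,
          if_neg (by omega), if_neg (by omega)]
        rfl
      rw [Function.iterate_succ_apply, step_append_singleton] at hj
      rw [← hasOutput_iterate 1, Function.iterate_one, step_append_singleton]
      split_ifs at hj with ha
      · rw [if_pos (hiff.2 ha), addUnit_comm]
        exact ih ha (fun b hb => hx b (by simp [hb])) hj
      · rw [if_neg (mt hiff.1 ha)]
        refine ih hnu (fun b hb => ?_) hj
        rcases List.mem_cons.1 hb with rfl | hb
        · omega
        · exact hx b (by simp [hb])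

/-- A letter `0` in front of the word only lengthens the first row of the output: it is inserted
when the other letters have been inserted or corotated once, and after that no letter is less than
`2`, so that the length of the first row does not matter any more. -/
theorem HasOutput.zero_cons {x mu : List ℕ} (h : HasOutput (x, []) mu) :
    HasOutput (0 :: x, []) (addUnit mu 0) := by
  have h1 : HasOutput ((pass x []).1, (pass x []).2) mu := by
    have := (hasOutput_append (x := []) (t := x)).1 h
    simpa using this
  have hp := isPartition_pass isPartition_nil x
  have h2 := h1.addUnit_zero hp fun a ha => two_le_of_mem_pass isPartition_nil ha
  rw [show 0 :: x = [0] ++ x from rfl, hasOutput_append, ← hasOutput_iterate 1,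
    Function.iterate_one, step_append_singleton,
    if_pos ((isPartition_addUnit_iff hp 0).2 (Or.inl rfl))]
  exact h2

theorem HasOutput.replicate_zero_append {x mu : List ℕ} (h : HasOutput (x, []) mu) (d : ℕ) :
    HasOutput (List.replicate d 0 ++ x, []) ((addUnit · 0)^[d] mu) := by
  induction d with
  | zero => exact h
  | succ d ih =>
    rw [Function.iterate_succ_apply', List.replicate_succ]
    exact ih.zero_cons

theorem sum_take_addUnit_zero_le (nu : List ℕ) (d k : ℕ) :
    (((addUnit · 0)^[d] nu).take k).sum ≤ d + (nu.take k).sum := by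
  have h1 : ∀ nu : List ℕ, ((addUnit nu 0).take k).sum ≤ 1 + (nu.take k).sum := by
    intro nu
    cases k with
    | zero => simp
    | succ k => cases nu <;> simp [addUnit]; omega
  induction d with
  | zero => simp
  | succ d ih =>
    rw [Function.iterate_succ_apply']
    have := h1 ((addUnit · 0)^[d] nu)
    omega

/-! ### Catabolizability -/

/-- Corotation of all letters of a final segment without `0`. -/
theorem IsCocharge.rotate {y t : List ℕ} (h : IsCocharge (y ++ t)) (ht : ∀ a ∈ t, 0 < a) :
    IsCocharge (t.map (· + 1) ++ y) := by
  induction t using List.reverseRecOn generalizing y with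
  | nil => simpa using h
  | append_singleton t a ih =>
    have ha : 0 < a := ht a (by simp)
    have h1 : IsCocharge ((y ++ t) ++ [a] ++ []) := by simpa using h
    have h2 := h1.corotate (by simpa using h1.mem_of_append_singleton ha (by simp)) (by simp)
    have h3 := ih (y := (a + 1) :: y) (by simpa using h2) fun b hb => ht b (by simp [hb])
    simpa using h3

/-- The condition for the letter `k + 1` of `x` is the one for the letter `k + 2` of the raised
word, in which the letters `0` at the end do not take part. -/
theorem IsCocharge.of_map_succ {x : List ℕ} {d : ℕ}
    (h : IsCocharge (x.map (· + 1) ++ List.replicate d 0)) : IsCocharge x := by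
  intro k hk
  have h1 := h (k + 1) (List.mem_append_left _ (List.mem_map.2 ⟨k + 1, hk, rfl⟩))
  have h2 : ∀ a, a + 1 ∉ List.replicate d 0 := fun a ha => by simp at ha
  rw [pair_sublist_append] at h1
  rcases h1 with h1 | h1 | h1
  · have h3 := h1.map (· - 1)
    rw [List.map_map] at h3
    simpa [Function.comp_def] using h3
  · exact absurd (h1.subset List.mem_cons_self) (h2 _)
  · exact absurd h1.2 (h2 _)

theorem IsCocharge.replicate_zero_append {x : List ℕ} (h : IsCocharge x) (d : ℕ) :
    IsCocharge (List.replicate d 0 ++ x) := by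
  intro k hk
  rcases List.mem_append.1 hk with hk | hk
  · simp at hk
  · exact (h k hk).trans (List.sublist_append_right _ _)

/-- The data of a tableau, with a labeling of its row reading word, on which the induction over
catabolisms is based: `R` is the first row, `T` consists of the other rows, and the labels `0` are
those of the first `k` entries of `R`. -/
structure LabeledTableau (l : ℕ → ℕ) (R : List ℕ) (T : List (List ℕ)) (k : ℕ) : Prop where
  isTableau : IsTableau (R :: T)
  isLabeling : IsLabeling l (rowWord T ++ R)
  le_length : k ≤ R.length
  eq_zero : ∀ a ∈ R.take k, l a = 0
  pos : ∀ a ∈ R.drop k, 0 < l a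

namespace LabeledTableau

variable {l : ℕ → ℕ} {R : List ℕ} {T : List (List ℕ)} {k : ℕ}

theorem pos_rowWord (h : LabeledTableau l R T k) {y : ℕ} (hy : y ∈ rowWord T) : 0 < l y :=
  IsLabeling.pos_of_rowWord (by rw [rowWord_cons]; exact h.isLabeling) h.isTableau hy

theorem map_take (h : LabeledTableau l R T k) : (R.take k).map l = List.replicate k 0 := by
  rw [List.eq_replicate_iff]
  refine ⟨by simp [h.le_length], fun b hb => ?_⟩
  obtain ⟨a, ha, rfl⟩ := List.mem_map.1 hb
  exact h.eq_zero a ha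

/-- The labels of the slice words `R.drop m ++ rowWord T`, for `m ≤ k`: the entries of `R` keep
their labels, and those of the other entries are lowered by one. -/
def sliceLabel (l : ℕ → ℕ) (T : List (List ℕ)) (a : ℕ) : ℕ :=
  if a ∈ rowWord T then l a - 1 else l a

theorem sliceLabel_of_mem_rowWord {a : ℕ} (ha : a ∈ rowWord T) : sliceLabel l T a = l a - 1 :=
  if_pos ha

theorem sliceLabel_of_mem (h : LabeledTableau l R T k) {a : ℕ} (ha : a ∈ R) :
    sliceLabel l T a = l a := by
  refine if_neg fun h' => ?_
  have := (List.nodup_append.1 (nodup_of_pairwise_labelRel h.isLabeling.1)).2.2 a h' a ha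
  exact this rfl

theorem map_sliceLabel_drop (h : LabeledTableau l R T k) (m : ℕ) :
    (R.drop m).map (sliceLabel l T) = (R.drop m).map l :=
  List.map_congr_left fun _ ha => h.sliceLabel_of_mem (List.mem_of_mem_drop ha)

theorem map_sliceLabel_rowWord :
    (rowWord T).map (sliceLabel l T) = ((rowWord T).map l).map (· - 1) := by
  rw [List.map_map]
  exact List.map_congr_left fun _ ha => sliceLabel_of_mem_rowWord ha

theorem map_drop (h : LabeledTableau l R T k) {m : ℕ} (hm : m ≤ k) :
    (R.drop m).map l = List.replicate (k - m) 0 ++ (R.drop k).map l := by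
  conv_lhs => rw [← List.take_append_drop k R]
  rw [List.drop_append_of_le_length (by simp [hm, h.le_length]),
    List.map_append, List.map_drop, h.map_take, List.drop_replicate]

theorem map_sliceLabel (h : LabeledTableau l R T k) {m : ℕ} (hm : m ≤ k) :
    (R.drop m ++ rowWord T).map (sliceLabel l T) =
      List.replicate (k - m) 0 ++ (R.drop k ++ rowWord T).map (sliceLabel l T) := by
  rw [List.map_append, List.map_append, h.map_sliceLabel_drop, h.map_sliceLabel_drop,
    h.map_drop hm, List.append_assoc]

/-- Raised by one, the labels of the slice word with all letters of label `0` removed are those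
obtained when the remaining letters of the first row are corotated. -/
theorem map_succ_sliceLabel (h : LabeledTableau l R T k) :
    ((R.drop k ++ rowWord T).map (sliceLabel l T)).map (· + 1) =
      ((R.drop k).map l).map (· + 1) ++ (rowWord T).map l := by
  rw [List.map_append, List.map_append, h.map_sliceLabel_drop, map_sliceLabel_rowWord,
    List.map_map (g := (· + 1)) (f := (· - 1))]
  congr 1
  conv_rhs => rw [← List.map_id ((rowWord T).map l)]
  refine List.map_congr_left fun b hb => ?_
  obtain ⟨a, ha, rfl⟩ := List.mem_map.1 hb
  exact Nat.succ_pred_eq_of_pos (h.pos_rowWord ha)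

/-- The slice words are labeled by `sliceLabel`. For `m < k`, the remaining entries of label `0`
stand in front and are smaller than all others, so that they keep the label `0`. -/
theorem isLabeling_slice (h : LabeledTableau l R T k) {m : ℕ} (hm : m ≤ k) :
    IsLabeling (sliceLabel l T) (R.drop m ++ rowWord T) := by
  have hp := h.isLabeling.1
  rw [List.pairwise_append] at hp
  constructor
  · rw [List.pairwise_append]
    refine ⟨(hp.2.1.sublist (List.drop_sublist m R)).imp_of_mem ?_, hp.1.imp_of_mem ?_, ?_⟩
    · intro a b ha hb hab
      unfold LabelRel at hab ⊢
      rwa [h.sliceLabel_of_mem (List.mem_of_mem_drop ha),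
        h.sliceLabel_of_mem (List.mem_of_mem_drop hb)]
    · intro a b ha hb hab
      have h1 := h.pos_rowWord ha
      have h2 := h.pos_rowWord hb
      unfold LabelRel at hab ⊢
      rw [sliceLabel_of_mem_rowWord ha, sliceLabel_of_mem_rowWord hb]
      omega
    · intro a ha b hb
      have ha' := List.mem_of_mem_drop ha
      have h1 := h.pos_rowWord hb
      have h2 := hp.2.2 b hb a ha'
      unfold LabelRel at h2 ⊢
      rw [h.sliceLabel_of_mem ha', sliceLabel_of_mem_rowWord hb]
      omega
  · rw [h.map_sliceLabel hm]
    refine IsCocharge.replicate_zero_append ?_ _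
    have h1 : IsCocharge ((rowWord T).map l ++ List.replicate k 0 ++ (R.drop k).map l) := by
      rw [← h.map_take, ← List.map_append, ← List.map_append, List.append_assoc,
        List.take_append_drop]
      exact h.isLabeling.2
    have h2 := h1.rotate fun b hb => by
      obtain ⟨a, ha, rfl⟩ := List.mem_map.1 hb
      exact h.pos a ha
    rw [← List.append_assoc, ← h.map_succ_sliceLabel] at h2
    exact h2.of_map_succ

theorem count_zero_eq (h : LabeledTableau l R T k) : R.countP (l · = 0) = k := by
  conv_lhs => rw [← List.take_append_drop k R]
  rw [List.countP_append, List.countP_eq_length.2 (by simpa using h.eq_zero),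
    List.countP_eq_zero.2 (by simpa using fun a ha => (h.pos a ha).ne')]
  simp [h.le_length]

/-- The labels `0` of the slice word are not more than those of the tableau. -/
theorem count_zero_le (h : LabeledTableau l R T k) :
    ((R.drop k ++ rowWord T).map (sliceLabel l T)).count 0 ≤ k := by
  have h1 : ((R.drop k).map (sliceLabel l T)).count 0 = 0 := by
    rw [h.map_sliceLabel_drop, List.count_eq_zero]
    intro h0
    obtain ⟨a, ha, ha0⟩ := List.mem_map.1 h0
    exact (h.pos a ha).ne' ha0
  have h2 : ((rowWord T).map (sliceLabel l T)).count 0 = (rowWord T).countP (l · = 1) := by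
    rw [List.count, List.countP_map]
    refine List.countP_congr fun a ha => ?_
    have := h.pos_rowWord ha
    simp only [Function.comp_apply, sliceLabel_of_mem_rowWord ha, beq_iff_eq, decide_eq_true_eq]
    omega
  rw [List.map_append, List.count_append, h1, h2, zero_add]
  have := IsLabeling.countP_rowWord_le (by rw [rowWord_cons]; exact h.isLabeling) h.isTableau
  rwa [h.count_zero_eq] at this

/-- The algorithm first corotates the letters of non-zero label in the first row, then inserts the
`k` letters of label `0`, and then continues with the slice word below a first row of length `k`. -/
theorem hasOutput (h : LabeledTableau l R T k) (hk : 0 < k) {mu : List ℕ}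
    (hmu : HasOutput ((R.drop k ++ rowWord T).map (sliceLabel l T), []) mu) :
    HasOutput ((rowWord T ++ R).map l, []) (k :: mu) := by
  have h1 := hmu.cons isPartition_nil hk (by simpa using h.count_zero_le)
  rw [h.map_succ_sliceLabel] at h1
  have h2 : (rowWord T ++ R).map l =
      ((rowWord T).map l ++ List.replicate k 0) ++ (R.drop k).map l := by
    rw [← h.map_take, ← List.map_append, ← List.map_append, List.append_assoc,
      List.take_append_drop]
  obtain ⟨j, rfl⟩ := Nat.exists_eq_add_of_le' hk
  rw [h2, hasOutput_append, pass_of_pos fun b hb => by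
    obtain ⟨a, ha, rfl⟩ := List.mem_map.1 hb
    exact h.pos a ha, ← List.append_assoc, hasOutput_append, pass_replicate_zero, List.nil_append]
  exact h1

/-- At most the `k` letters of label `0` can be removed by a catabolism. -/
theorem le_of_isCatabolizable (h : LabeledTableau l R T k) {m : ℕ} (hm : m ≤ R.length)
    (hlt : ∀ a ∈ R.take m, ∀ b ∈ R.drop m ++ rowWord T, a < b) : m ≤ k := by
  by_contra hkm
  push Not at hkm
  have hkR : k < R.length := hkm.trans_le hm
  -- `t` is the first entry of non-zero label, and `d` an entry of label `1` below the first row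
  obtain ⟨t, ht, htm⟩ : ∃ t, t ∈ R.drop k ∧ t ∈ R.take m :=
    ⟨R[k], List.mem_drop_iff_getElem.2 ⟨0, by simpa using hkR, by simp⟩,
      List.mem_take_iff_getElem.2 ⟨k, by omega, rfl⟩⟩
  have htR : t ∈ R := List.mem_of_mem_drop ht
  have htl := h.pos t ht
  have h1 : 0 + 1 ∈ (rowWord T ++ R).map l :=
    h.isLabeling.2.mem_of_le (List.mem_map.2 ⟨t, by simp [htR], rfl⟩) htl
  have h2 := h.isLabeling.2 0 h1
  have hp := h.isLabeling.1
  rw [List.pairwise_append] at hp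
  rw [List.map_append, pair_sublist_append] at h2
  have hd : ∃ d ∈ rowWord T, l d = 1 := by
    rcases h2 with h2 | h2 | h2
    · obtain ⟨e, he, he0⟩ := List.mem_map.1 (h2.subset (by simp : 0 ∈ [0 + 1, 0]))
      exact absurd he0 (h.pos_rowWord he).ne'
    · have h3 : (R.map l).Pairwise (· ≤ ·) := by
        rw [List.pairwise_map]
        exact hp.2.1.imp₂ (fun a b h1 h2 => h1.le_of_lt h2) h.isTableau.1
      have := h3.sublist h2
      simp at this
    · exact List.mem_map.1 h2.1
  obtain ⟨d, hd, hd1⟩ := hd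
  have h3 := hlt t htm d (by simp [hd])
  have h4 := hp.2.2 d hd t htR
  unfold LabelRel at h4
  omega

end LabeledTableau

theorem exists_labeledTableau {l : ℕ → ℕ} {R : List ℕ} {T : List (List ℕ)}
    (hT : IsTableau (R :: T)) (h : IsLabeling l (rowWord T ++ R)) :
    ∃ k, LabeledTableau l R T k := by
  have hp := (List.pairwise_append.1 h.1).2.1
  obtain ⟨k, hk, h1, h2⟩ := exists_split (hp.imp₂ (fun a b h1 h2 => h1.le_of_lt h2) hT.1)
  exact ⟨k, hT, h, hk, h1, h2⟩

/-- The output of the algorithm is the greatest partition for which the insertion tableau is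
catabolizable. -/
theorem IsLabeling.exists_output {l : ℕ → ℕ} {w : List ℕ} (h : IsLabeling l w) :
    ∃ mu, HasOutput (w.map l, []) mu ∧ mu.sum = w.length ∧
      IsCatabolizable mu (insertionTableau w) ∧
      ∀ lam, IsPartition lam → IsCatabolizable lam (insertionTableau w) → DominanceLE lam mu := by
  induction hn : w.length using Nat.strong_induction_on generalizing l w with
  | _ n ih =>
  subst hn
  have hnd := nodup_of_pairwise_labelRel h.1
  obtain ⟨hT, hK⟩ := insertionTableau_spec hnd
  obtain ⟨hl, hout⟩ := h.knuthEquiv hK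
  have hlen := hK.perm.length_eq
  rcases hP : insertionTableau w with _ | ⟨R, T⟩
  · rw [hP] at hlen
    obtain rfl : w = [] := List.eq_nil_of_length_eq_zero (by simpa [rowWord] using hlen)
    refine ⟨[], ⟨0, rfl⟩, rfl, rfl, ?_⟩
    rintro (_ | ⟨m, lam⟩) hlam hcat
    · intro j
      simp
    · have h1 := hlam.2 m (by simp)
      have h2 := hcat.1
      simp at h2
      omega
  · rw [hP, rowWord_cons] at hl hout hlen
    rw [hP] at hT
    obtain ⟨k, hLT⟩ := exists_labeledTableau hT hl
    rw [List.length_append] at hlen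
    have hRl := hLT.le_length
    have hslice : ∀ m ≤ k, 0 < m → (R.drop m ++ rowWord T).length < w.length := by
      intro m hm h0
      simp only [List.length_append, List.length_drop]
      omega
    have hw : w ≠ [] := by
      rintro rfl
      simp [insertionTableau] at hP
    have hk : 0 < k := by
      by_contra hk
      obtain rfl : k = 0 := by omega
      obtain ⟨a, ha⟩ := List.exists_mem_of_ne_nil _ (List.ne_nil_of_length_pos
        (by rw [List.length_append, ← hlen]; exact List.length_pos_of_ne_nil hw) :
          rowWord T ++ R ≠ [])
      have h0 := hl.2.mem_of_le (List.mem_map.2 ⟨a, ha, rfl⟩) (Nat.zero_le _)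
      obtain ⟨b, hb, hb0⟩ := List.mem_map.1 h0
      rcases List.mem_append.1 hb with hb | hb
      · exact (hLT.pos_rowWord hb).ne' hb0
      · exact (hLT.pos b hb).ne' hb0
    obtain ⟨mu, ho, hs, hc, -⟩ := ih _ (hslice k le_rfl hk) (hLT.isLabeling_slice le_rfl) rfl
    refine ⟨k :: mu, hout _ (hLT.hasOutput hk ho), ?_, ⟨hRl, ?_, hc⟩, ?_⟩
    · rw [List.sum_cons, hs, List.length_append, List.length_drop]
      omega
    · intro a ha b hb
      rcases List.mem_append.1 hb with hb | hb
      · have h1 := hT.1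
        rw [List.headD_cons] at ha hb
        rw [← List.take_append_drop k R, List.pairwise_append] at h1
        exact h1.2.2 a ha b hb
      · have h1 := (List.pairwise_append.1 hl.1).2.2 b hb a (List.mem_of_mem_take ha)
        have h2 := hLT.eq_zero a ha
        have h3 := hLT.pos_rowWord hb
        unfold LabelRel at h1
        omega
    · rintro (_ | ⟨m, lam⟩) hlam hcat
      · intro j
        simp
      · obtain ⟨hmR, hlt, hcat⟩ := hcat
        have hmk : m ≤ k := hLT.le_of_isCatabolizable hmR hlt
        have hm : 0 < m := hlam.2 m (by simp)
        obtain ⟨mu', ho', -, -, hmax⟩ :=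
          ih _ (hslice m hmk hm) (hLT.isLabeling_slice hmk) rfl
        -- removing `m` instead of `k` entries puts `k - m` letters `0` in front of the labels
        rw [hLT.map_sliceLabel hmk] at ho'
        have he := hasOutput_unique ho' (ho.replicate_zero_append (k - m))
        have hdom := hmax lam ⟨hlam.1.of_cons, fun a ha => hlam.2 a (by simp [ha])⟩ hcat
        intro j
        cases j with
        | zero => simp
        | succ j =>
          have h1 := hdom j
          have h2 := sum_take_addUnit_zero_le mu (k - m) j
          rw [← he] at h2
          simp only [List.take_succ_cons, List.sum_cons]
          omega

theorem eq_of_dominanceLE {mu lam : List ℕ} (hmu : IsPartition mu) (hlam : IsPartition lam)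
    (h : DominanceLE mu lam) (h' : DominanceLE lam mu) : mu = lam := by
  induction mu generalizing lam with
  | nil =>
    cases lam with
    | nil => rfl
    | cons k lam =>
      have h1 := h' 1
      have h2 := hlam.2 k (by simp)
      simp at h1
      omega
  | cons j mu ih =>
    cases lam with
    | nil =>
      have h1 := h 1
      have h2 := hmu.2 j (by simp)
      simp at h1
      omega
    | cons k lam =>
      have h1 := h 1
      have h2 := h' 1
      simp at h1 h2
      obtain rfl : j = k := by omega
      rw [isPartition_cons] at hmu hlam
      congr 1
      refine ih hmu.2.2 hlam.2.2 (fun i => ?_) (fun i => ?_)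
      · simpa using h (i + 1)
      · simpa using h' (i + 1)

theorem length_flatten_eq (T : List (List ℕ)) : T.flatten.length = (rowWord T).length := by
  induction T with
  | nil => rfl
  | cons r T ih =>
    rw [rowWord_cons, List.flatten_cons, List.length_append, List.length_append, ih, Nat.add_comm]

theorem IsLabeling.isCtype_iff {l : ℕ → ℕ} {w mu : List ℕ} (h : IsLabeling l w)
    (hmu : HasOutput (w.map l, []) mu) (lam : List ℕ) :
    IsCtype (insertionTableau w) lam ↔ lam = mu := by
  obtain ⟨mu', ho, hs, hc, hmax⟩ := h.exists_output
  obtain rfl := hasOutput_unique hmu ho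
  have hp : IsPartition mu := ho.isPartition isPartition_nil
  have hlen : mu.sum = (insertionTableau w).flatten.length := by
    rw [length_flatten_eq, hs,
      (insertionTableau_spec (nodup_of_pairwise_labelRel h.1)).2.perm.length_eq]
  constructor
  · rintro ⟨⟨h1, -, h3⟩, h4⟩
    exact eq_of_dominanceLE h1 hp (hmax lam h1 h3) (h4 mu hp hlen hc)
  · rintro rfl
    exact ⟨⟨hp, hlen, hc⟩, fun lam h1 _ h3 => hmax lam h1 h3⟩

/-! ### States of the algorithm -/

/-- The row reading word of the superstandard tableau of shape `ν`, with all entries raised by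
`s`. -/
def superstandardWord (s : ℕ) (nu : List ℕ) : List ℕ :=
  rowWord (nu.mapIdx fun i k => List.replicate k (i + s))

theorem superstandardWord_cons (s k : ℕ) (nu : List ℕ) :
    superstandardWord s (k :: nu) = superstandardWord (s + 1) nu ++ List.replicate k s := by
  rw [superstandardWord, List.mapIdx_cons, rowWord_cons, superstandardWord, Nat.zero_add]
  simp only [Nat.add_assoc, Nat.add_comm 1 s]

theorem superstandardWord_addUnit (s : ℕ) (nu : List ℕ) (a : ℕ) :
    (superstandardWord s (addUnit nu a)).Perm ((a + s) :: superstandardWord s nu) := by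
  induction nu generalizing s a with
  | nil =>
    induction a generalizing s with
    | zero => simp [addUnit, superstandardWord_cons]; exact .refl _
    | succ a ih =>
      rw [addUnit, superstandardWord_cons, List.replicate_zero, List.append_nil]
      have := ih (s + 1)
      rwa [show a + (s + 1) = a + 1 + s by omega] at this
  | cons k nu ih =>
    cases a with
    | zero =>
      rw [addUnit, superstandardWord_cons, superstandardWord_cons, List.replicate_succ,
        Nat.zero_add]
      exact List.perm_middle
    | succ a =>
      rw [addUnit, superstandardWord_cons, superstandardWord_cons, ← List.cons_append]
      have := ih (s + 1) a
      rw [show a + (s + 1) = a + 1 + s by omega] at this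
      exact this.append_right _

theorem mem_superstandardWord {s : ℕ} {nu : List ℕ} (hnu : IsPartition nu) {a : ℕ} :
    a ∈ superstandardWord s nu ↔ s ≤ a ∧ a < s + nu.length := by
  induction nu generalizing s with
  | nil => simp [superstandardWord, rowWord]
  | cons k nu ih =>
    rw [isPartition_cons] at hnu
    rw [superstandardWord_cons, List.mem_append, ih hnu.2.2, List.mem_replicate, List.length_cons]
    omega

theorem pair_sublist_superstandardWord {s : ℕ} {nu : List ℕ} (hnu : IsPartition nu) {a : ℕ}
    (hs : s ≤ a) (ha : a + 1 < s + nu.length) : [a + 1, a].Sublist (superstandardWord s nu) := by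
  induction nu generalizing s with
  | nil => simp at ha; omega
  | cons k nu ih =>
    rw [isPartition_cons] at hnu
    rw [List.length_cons] at ha
    rw [superstandardWord_cons, pair_sublist_append]
    rcases hs.eq_or_lt with rfl | hs
    · refine Or.inr (Or.inr ⟨?_, ?_⟩)
      · rw [mem_superstandardWord hnu.2.2]
        omega
      · simp [hnu.1.ne']
    · exact Or.inl (ih hnu.2.2 hs (by omega))

/-- The word `x rowword(Z_ν)` of a word-partition pair `(x, ν)`. -/
def stateWord (s : List ℕ × List ℕ) : List ℕ :=
  s.1 ++ superstandardWord 0 s.2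

theorem length_addUnit {nu : List ℕ} {a : ℕ} (ha : a ≤ nu.length) :
    (addUnit nu a).length = max nu.length (a + 1) := by
  induction nu generalizing a with
  | nil =>
    obtain rfl : a = 0 := by simpa using ha
    rfl
  | cons k nu ih =>
    cases a with
    | zero => simp [addUnit]
    | succ a =>
      rw [addUnit, List.length_cons, ih (by simpa using ha), List.length_cons]
      omega

theorem le_length_of_isPartition_addUnit {nu : List ℕ} (hnu : IsPartition nu) {a : ℕ}
    (h : IsPartition (addUnit nu a)) : a ≤ nu.length := by
  rw [isPartition_addUnit_iff hnu] at h
  by_contra hc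
  have := getD_pos_iff hnu (a - 1)
  omega

theorem isPartition_addUnit_length {nu : List ℕ} (hnu : IsPartition nu) :
    IsPartition (addUnit nu nu.length) := by
  rw [isPartition_addUnit_iff hnu]
  have h1 := getD_pos_iff hnu nu.length
  have h2 := getD_pos_iff hnu (nu.length - 1)
  omega

/-- A step of the algorithm preserves the cocharge condition. When a letter is inserted, it only
moves to the right past greater letters. A corotated letter `a` occurs a second time: in `Z_ν` if
the row of `a` is not empty, and otherwise to the left of an `a - 1`. -/
theorem IsCocharge.step {s : List ℕ × List ℕ} (hs : IsPartition s.2)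
    (h : IsCocharge (stateWord s)) : IsCocharge (stateWord (step s)) := by
  obtain ⟨x, nu⟩ := s
  rcases List.eq_nil_or_concat x with rfl | ⟨y, a, rfl⟩
  · exact h
  rw [List.concat_eq_append] at h ⊢
  rw [step_append_singleton]
  simp only [stateWord] at hs h
  split_ifs with ha
  · have hal := le_length_of_isPartition_addUnit hs ha
    have hlen := length_addUnit hal
    intro k hk
    simp only [stateWord, List.mem_append, mem_superstandardWord ha, hlen, Nat.zero_le,
      true_and, zero_add] at hk
    have hk' := h k (by
      simp only [List.mem_append, mem_superstandardWord hs, List.mem_singleton, Nat.zero_le,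
        true_and, zero_add]
      rcases hk with hk | hk
      · exact Or.inl (Or.inl hk)
      · omega)
    by_cases hkl : k + 1 < (addUnit nu a).length
    · simp only [stateWord, pair_sublist_append]
      exact Or.inr (Or.inl (pair_sublist_superstandardWord ha (Nat.zero_le _) (by omega)))
    · simp only [stateWord, pair_sublist_append, List.mem_append, List.mem_singleton,
        mem_superstandardWord hs, mem_superstandardWord ha, Nat.zero_le, true_and,
        zero_add] at hk' ⊢
      have hsub : [k + 1, k].Sublist (superstandardWord 0 nu) → False := fun h' => by
        have := h'.subset (List.mem_cons_self)
        rw [mem_superstandardWord hs] at this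
        omega
      have hsub' : ¬ [k + 1, k].Sublist [a] := by simp
      rcases hk' with (h1 | h1 | h1) | h1 | h1
      · exact Or.inl h1
      · exact absurd h1 hsub'
      · exact Or.inr (Or.inr ⟨h1.1, by omega⟩)
      · exact (hsub h1).elim
      · rcases h1 with ⟨h1 | h1, h2⟩
        · exact Or.inr (Or.inr ⟨h1, by omega⟩)
        · omega
  · have ha0 : a ≠ 0 := by
      rintro rfl
      exact ha ((isPartition_addUnit_iff hs 0).2 (Or.inl rfl))
    have hal : a ≠ nu.length := by
      rintro rfl
      exact ha (isPartition_addUnit_length hs)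
    refine h.corotate ?_ fun k hk hka => ?_
    · rw [List.mem_append, mem_superstandardWord hs]
      rcases Nat.lt_or_ge a nu.length with h1 | h1
      · exact Or.inr (by omega)
      · refine Or.inl (h.mem_of_append_singleton (by omega) ?_)
        rw [mem_superstandardWord hs]
        omega
    · rw [mem_superstandardWord hs] at hk
      exact pair_sublist_superstandardWord hs (Nat.zero_le _) (by omega)

/-- A step does not change the length of the word of the pair, and it either shortens the first
component or increases the sum of the letters. -/
theorem stateWord_step {s : List ℕ × List ℕ} (hs : s.1 ≠ []) :
    (stateWord (step s)).length = (stateWord s).length ∧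
      s.1.length + (stateWord (step s)).sum = (step s).1.length + (stateWord s).sum + 1 := by
  obtain ⟨x, nu⟩ := s
  rcases List.eq_nil_or_concat x with rfl | ⟨y, a, rfl⟩
  · exact absurd rfl hs
  rw [List.concat_eq_append, step_append_singleton]
  have hp := superstandardWord_addUnit 0 nu a
  have h1 := hp.length_eq
  have h2 := hp.sum_eq
  split_ifs <;> simp [stateWord, h1, h2] <;> omega

/-- The invariants of the states, among them the bound on the number of steps by the sum of the
letters. -/
theorem stateWord_state {n : ℕ} {u : List ℕ} (hu : IsStandardWord n u) (k : ℕ) :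
    IsPartition (state u k).2 ∧ IsCocharge (stateWord (state u k)) ∧
      (stateWord (state u k)).length = n ∧
      ((state u k).1 ≠ [] → k + (state u k).1.length ≤ n + (stateWord (state u k)).sum) := by
  have hlen : u.length = n := by
    have := List.Perm.length_eq hu
    simpa using this
  induction k with
  | zero =>
    refine ⟨isPartition_nil, ?_, ?_, ?_⟩
    · simpa [state, stateWord, superstandardWord, rowWord, cochargeLabeling] using hu.isLabeling.2
    · simp [state, stateWord, superstandardWord, rowWord, cochargeLabeling, hlen]
    · simp [state, cochargeLabeling, hlen]
  | succ k ih =>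
    have he : state u (k + 1) = step (state u k) := Function.iterate_succ_apply' _ _ _
    obtain ⟨h1, h2, h3, h4⟩ := ih
    rw [he]
    refine ⟨isPartition_step h1, h2.step h1, ?_⟩
    by_cases hnil : (state u k).1 = []
    · have hst : step (state u k) = state u k := by
        rw [show state u k = ([], (state u k).2) from Prod.ext hnil rfl, step_nil]
      rw [hst]
      exact ⟨h3, fun h => absurd hnil h⟩
    · have h5 := stateWord_step hnil
      have h6 := h4 hnil
      exact ⟨h5.1.trans h3, fun _ => by omega⟩

/-- The labels of a standard word of length `n` are at most `0, 1, …, n - 1`. -/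
theorem sum_cochargeLabeling_le {n : ℕ} {w : List ℕ} (hw : IsStandardWord n w) :
    (cochargeLabeling w).sum ≤ n.choose 2 := by
  have hle : ∀ i, cochargeLabel w (i + 1) ≤ i := by
    intro i
    induction i with
    | zero => exact le_rfl
    | succ i ih =>
      rw [cochargeLabel_succ w (by omega)]
      split_ifs <;> omega
  have hsum : ∀ n, ((List.range' 1 n).map (cochargeLabel w)).sum ≤ n.choose 2 := by
    intro n
    induction n with
    | zero => simp
    | succ n ih =>
      have := hle n
      rw [List.range'_1_concat, List.map_append, List.sum_append, Nat.choose_succ_succ' n 1,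
        Nat.choose_one_right, Nat.add_comm 1 n]
      simp only [List.map_cons, List.map_nil, List.sum_singleton, Nat.reduceAdd]
      omega
  rw [cochargeLabeling, (List.Perm.map (cochargeLabel w) hw).sum_eq]
  exact hsum n

theorem exists_state_eq_nil {n : ℕ} {u : List ℕ} (hu : IsStandardWord n u) :
    ∃ k, k ≤ n + n.choose 2 ∧ (state u k).1 = [] := by
  refine ⟨n + n.choose 2, le_rfl, ?_⟩
  by_contra hnil
  obtain ⟨-, h2, h3, h4⟩ := stateWord_state hu (n + n.choose 2)
  obtain ⟨w, hw, he⟩ := h2.exists_standardWord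
  rw [h3] at hw
  have h5 := sum_cochargeLabeling_le hw
  rw [he] at h5
  have h6 := List.length_pos_of_ne_nil hnil
  have h7 := h4 hnil
  omega

theorem hasOutput_output {n : ℕ} {u : List ℕ} (hu : IsStandardWord n u) :
    HasOutput (cochargeLabeling u, []) (output u) := by
  obtain ⟨k, -, hk⟩ := exists_state_eq_nil hu
  have h : HasOutput (cochargeLabeling u, []) (state u k).2 := ⟨k, Prod.ext hk rfl⟩
  rwa [output_eq h]

theorem output_eq_of_wordMove {n : ℕ} {u v : List ℕ} (hu : IsStandardWord n u) (huv : u.Perm v)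
    (h : WordMove (u.map (cochargeLabel u)) (v.map (cochargeLabel u)))
    (hv : IsLabeling (cochargeLabel u) v) : output u = output v := by
  have hv' : IsStandardWord n v := huv.symm.trans hu
  symm
  apply output_eq
  rw [hv.cochargeLabeling_eq hv']
  exact h.hasOutput isPartition_nil (hasOutput_output hu)

/-- A non-zero corotation is the first step of the algorithm, since only `0` can be inserted into
the empty partition. -/
theorem output_eq_of_corotation {n : ℕ} {u v : List ℕ} (hu : IsStandardWord n u)
    (h : IsNonzeroCorotation u v) : output u = output v := by
  obtain ⟨w, a, rfl, rfl, -, ha⟩ := h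
  have hl := hu.isLabeling
  have hv := hl.corotate ha
  have hv' : IsStandardWord n (a :: w) := (List.perm_append_singleton a w).symm.trans hu
  have ho := hasOutput_output hu
  symm
  apply output_eq
  have hna : a ∉ w := fun h => by
    have := (List.nodup_append.1 hu.nodup).2.2 a h a (by simp)
    exact this rfl
  rw [hv.cochargeLabeling_eq hv', List.map_cons, Function.update_self,
    List.map_congr_left fun b hb => Function.update_of_ne (ne_of_mem_of_not_mem hb hna) _ _]
  rw [cochargeLabeling, List.map_append, List.map_singleton, ← hasOutput_iterate 1,
    Function.iterate_one, step_append_singleton, if_neg] at ho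
  · exact ho
  · rw [isPartition_addUnit_iff isPartition_nil]
    simp only [List.getD_nil, lt_self_iff_false, or_false]
    omega

end CatabolismInsertion

theorem mainTheorem1 (n : ℕ) (u : List ℕ) (hu : IsStandardWord n u) :
    (∀ k : ℕ, IsPartition (state u k).2 ∧
      ∃ w : List ℕ, IsStandardWord n w ∧
        (state u k).1 ++ rowWord (superstandard (state u k).2) = cochargeLabeling w) ∧
    (∃ k : ℕ, k ≤ n + n.choose 2 ∧ (state u k).1 = []) ∧
    (∀ v : List ℕ, IsNonzeroCorotation u v → output u = output v) ∧
    (∀ v : List ℕ, IsCatabolismTransformation u v → output u = output v) ∧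
    (∀ v : List ℕ, IsKnuthTransformation u v → output u = output v) ∧
    (∀ lam : List ℕ, IsCtype (insertionTableau u) lam ↔ lam = output u) := by
  refine ⟨fun k => ?_, exists_state_eq_nil hu, fun v => output_eq_of_corotation hu, ?_, ?_,
    hu.isLabeling.isCtype_iff (hasOutput_output hu)⟩
  · obtain ⟨h1, h2, h3, -⟩ := stateWord_state hu k
    obtain ⟨w, hw, he⟩ := h2.exists_standardWord
    rw [h3] at hw
    exact ⟨h1, w, hw, he.symm⟩
  · rintro v ⟨p, q, a, b, rfl, rfl, hab⟩
    rw [lt_abs] at hab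
    have h := hu.isLabeling.swap (by omega)
    exact output_eq_of_wordMove hu (.append_right _ (.append_left _ (.swap _ _ _))) h.1 h.2
  · intro v hv
    have h := hu.isLabeling.knuth hv
    exact output_eq_of_wordMove hu hv.knuthEquiv.perm h.1 h.2
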